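/- Let $\mathfrak g$ be a finite-dimensional complex simple Lie algebra that is simply laced, with Cartan subalgebra $\mathfrak h$ and Chevalley generators $x_i^{\pm}, h_i$ ($i\in I$), and let $\mathfrak n^+$ be the subalgebra generated by the $x_i^+$. Let $\sigma$ be a nontrivial diagram automorphism of $\mathfrak g$, so that $\sigma(x_i^\pm)=x_{\sigma(i)}^\pm$ and $\sigma(h_i)=h_{\sigma(i)}$ for a permutation $\sigma$ of $I$; let $m$ be its order, $\zeta$ a primitive $m$-th root of unity, $\mathfrak g_\epsilon=\{x\in\mathfrak g:\sigma(x)=\zeta^{\epsilon}x\}$ for $\epsilon\in\mathbf Z/m$, and let $I_0\subset I$ be a set of representatives of the $\sigma$-orbits. Let $L^\sigma(\mathfrak g)$ be the twisted loop algebra, that is, the fixed points of the automorphism $x\otimes t^k\mapsto\zeta^k\sigma(x)\otimes t^k$ of $\mathfrak g\otimes\mathbf C[t,t^{-1}]$, and let $L^\sigma(\mathfrak n^+)=L^\sigma(\mathfrak g)\cap(\mathfrak n^+\otimes\mathbf C[t,t^{-1}])$. If $\mathfrak g$ has type $A_{2n}$, there is exactly one $i\in I_0$ that is joined to $\sigma(i)$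 by an edge of the Dynkin diagram; it is denoted by $n$, and we write $n+1=\sigma(n)$. In all other types no node is joined to its image. Let $y_i$ stand for $h_i$ or $x_i^-$. For $i\in I_0$ and $\epsilon\in\mathbf Z/m$ put $y_{i,\epsilon}=\sum_{j=0}^{m-1}\zeta^{-j\epsilon}y_{\sigma^j(i)}\in\mathfrak g_\epsilon$ if $\sigma(i)\neq i$, and $y_{i,0}=y_i$, $y_{i,\epsilon}=0$ for $\epsilon\ne0$ if $\sigma(i)=i$; except that for $i=n$ in type $A_{2n}$ we put $h_{n,0}=2(h_n+h_{n+1})$, $h_{n,1}=h_n-h_{n+1}$ and $x_{n,0}^-=\sqrt2\,(x_n^-+x_{n+1}^-)$. The elements $h_{i,0}$, $i\in I_0$, are a basis of $\mathfrak h_0=\mathfrak h\cap\mathfrak g_0$. Define formal power series in $u$ over the enveloping algebra of $L^\sigma(\mathfrak g)$ by $$\mathbf p^{\pm}_{i,\sigma}(u)=\exp\Big(-\sum_{r\ge1}\frac{h_{i,\mp r}\otimes t^{\pm r}}{r}u^r\Big)\ \text{ if }\sigma(i)\ne i\text{ (and }i\neq n\text{ in type }A_{2n}),$$ $$\mathbf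 p^{\pm}_{i,\sigma}(u)=\exp\Big(-\sum_{k\ge1}\frac{h_{i,0}\otimes t^{\pm mk}}{k}u^k\Big)\ \text{ if }\sigma(i)=i,$$ $$\mathbf p^{\pm}_{n,\sigma}(u)=\exp\Big(-\sum_{k\ge1}\frac{\frac12h_{n,0}\otimes t^{\pm2k}}{2k}u^{2k}+\sum_{k\ge1}\frac{h_{n,1}\otimes t^{\pm(2k-1)}}{2k-1}u^{2k-1}\Big)\ \text{ in type }A_{2n}.$$ Let $P_\sigma^+$ be the set of $\lambda\in\mathfrak h_0^*$ with $\lambda(h_{i,0})\in\mathbf Z_{\ge0}$ for all $i\in I_0$, and with $\lambda(h_{n,0})$ even in type $A_{2n}$. For $\lambda\in P^+_\sigma$ and $a\in\mathbf C^\times$ let $\boldsymbol\pi^\sigma_{\lambda,a}$ be the $I_0$-tuple of polynomials in $u$ whose entry at $i$ is $(1-a^mu)^{\lambda(h_{i,0})}$ if $\sigma(i)=i$, $(1-au)^{\lambda(h_{n,0})/2}$ if $i=n$ in type $A_{2n}$, and $(1-au)^{\lambda(h_{i,0})}$ otherwise. Let $\mathcal P^+_\sigma$ be the monoid, under componentwise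 multiplication, generated by all these tuples. For $\boldsymbol\pi^\sigma=(\pi_i)_{i\in I_0}\in\mathcal P^+_\sigma$ put $\pi_i^+=\pi_i$ and $\pi_i^-=\prod_k(1-a_k^{-1}u)$ if $\pi_i=\prod_k(1-a_ku)$ with all $a_k\neq0$, and let $\lambda_{\boldsymbol\pi}\in P^+_\sigma$ be given by $\lambda_{\boldsymbol\pi}(h_{i,0})=\deg\pi_i$, except that $\lambda_{\boldsymbol\pi}(h_{n,0})=2\deg\pi_n$ in type $A_{2n}$. The twisted Weyl module $W(\boldsymbol\pi^\sigma)$ is the $L^\sigma(\mathfrak g)$-module generated by an element $w$ with the relations $$L^\sigma(\mathfrak n^+)w=0,\quad hw=\lambda_{\boldsymbol\pi}(h)w\ (h\in\mathfrak h_0),\quad (x_{i,0}^-\otimes 1)^{\lambda_{\boldsymbol\pi}(h_{i,0})+1}w=0,\quad \big(\mathbf p^\pm_{i,\sigma}(u)-\pi_i^\pm(u)\big)w=0\qquad(i\in I_0).$$ Proposition. For every $\boldsymbol\pi^\sigma\in\mathcal P_\sigma^+$, the $L^\sigma(\mathfrak g)$-module $W(\boldsymbol\pi^\sigma)$ is finite-dimensional.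 -/

import Mathlib

open scoped TensorProduct Polynomial

noncomputable section

namespace TwistedLoop

variable {ι L : Type*} [Fintype ι] [LieRing L] [LieAlgebra ℂ L]
  {H : LieSubalgebra ℂ L}

/-- A nontrivial diagram automorphism `σ` of the Lie algebra with Chevalley generators
`B.e i = x⁺_i`, `B.f i = x⁻_i`, `B.h i = h_i` (`i ∈ ι`, the nodes of the Dynkin diagram), together
with the choices that enter the definition of the twisted Weyl modules: a primitive `m`-th root
of unity `ζ`, where `m` is the order of `σ`, and a set `I₀` of representatives of the `σ`-orbits
of nodes. -/
structure DiagramAutomorphism (B : LieAlgebra.Basis ι H) where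
  /-- the automorphism of the Lie algebra -/
  σ : L ≃ₗ⁅ℂ⁆ L
  /-- the induced permutation of the nodes -/
  perm : Equiv.Perm ι
  map_e : ∀ i, σ (B.e i) = B.e (perm i)
  map_f : ∀ i, σ (B.f i) = B.f (perm i)
  perm_ne_one : perm ≠ 1
  /-- the primitive root of unity -/
  ζ : ℂˣ
  isPrimitiveRoot : IsPrimitiveRoot ζ (orderOf perm)
  /-- the chosen representatives of the orbits -/
  I₀ : Finset ι
  existsUnique_rep : ∀ i, ∃! j, j ∈ I₀ ∧ perm.SameCycle i j

/-- The element `x ⊗ t^k` of the loop algebra. -/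
def tens (x : L) (k : ℤ) : LieAlgebra.loopAlgebra ℂ ℤ L :=
  AddMonoidAlgebra.single k (1 : ℂ) ⊗ₜ[ℂ] x

/-- The algebra homomorphism `t ↦ a t` of `ℂ[t, t⁻¹]`. -/
def rescale (a : ℂˣ) : AddMonoidAlgebra ℂ ℤ →ₐ[ℂ] AddMonoidAlgebra ℂ ℤ :=
  AddMonoidAlgebra.lift ℂ (AddMonoidAlgebra ℂ ℤ) ℤ
    { toFun := fun k => AddMonoidAlgebra.single k.toAdd ((a ^ k.toAdd : ℂˣ) : ℂ)
      map_one' := by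
        rw [toAdd_one, zpow_zero, Units.val_one, AddMonoidAlgebra.one_def]
      map_mul' := fun k l => by
        rw [AddMonoidAlgebra.single_mul_single, toAdd_mul, zpow_add, Units.val_mul] }

/-- The exponential `∑ₙ Sⁿ / n!` of a power series `S` without constant term over a (possibly
noncommutative) `ℂ`-algebra; `Sⁿ` does not contribute to the coefficient of `u^k` if `n > k`. -/
def expSeries {A : Type*} [Ring A] [Algebra ℂ A] (S : PowerSeries A) : PowerSeries A :=
  PowerSeries.mk fun k =>
    ∑ n ∈ Finset.range (k + 1), ((n.factorial : ℂ)⁻¹) • PowerSeries.coeff k (S ^ n)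

/-- For `p = ∏ (1 - a_k u)` with all `a_k ≠ 0`, this is `p⁻ = ∏ (1 - a_k⁻¹ u)`. -/
def minus (p : ℂ[X]) : ℂ[X] := Polynomial.C (p.leadingCoeff⁻¹) * p.reverse

lemma minus_mul (p q : ℂ[X]) : minus (p * q) = minus p * minus q := by
  simp only [minus, Polynomial.leadingCoeff_mul, mul_inv, Polynomial.C_mul,
    Polynomial.reverse_mul_of_domain]
  ring

lemma minus_one_sub (a : ℂ) (ha : a ≠ 0) :
    minus (1 - Polynomial.C a * Polynomial.X) =
      1 - Polynomial.C a⁻¹ * Polynomial.X := by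
  have h1 : (1 - Polynomial.C a * Polynomial.X : ℂ[X])
      = Polynomial.C (-a) * Polynomial.X + Polynomial.C 1 := by
    simp; ring
  have hd : (Polynomial.C (-a) * Polynomial.X + Polynomial.C 1 : ℂ[X]).natDegree = 1 :=
    Polynomial.natDegree_linear (neg_ne_zero.mpr ha)
  have hl : (Polynomial.C (-a) * Polynomial.X + Polynomial.C 1 : ℂ[X]).leadingCoeff = -a :=
    Polynomial.leadingCoeff_linear (neg_ne_zero.mpr ha)
  have hr : (Polynomial.C (-a) * Polynomial.X + Polynomial.C 1 : ℂ[X]).reverse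
      = Polynomial.C (-a) + Polynomial.X := by
    rw [Polynomial.reverse, hd]
    simp only [Polynomial.reflect_add, Polynomial.reflect_C_mul, Polynomial.reflect_C]
    rw [← pow_one (Polynomial.X : ℂ[X]), Polynomial.reflect_monomial]
    simp [Polynomial.revAt_le (le_refl 1)]
  rw [minus, h1, hl, hr]
  have : (Polynomial.C (-a)⁻¹ * Polynomial.C (-a) : ℂ[X]) = 1 := by
    rw [← Polynomial.C_mul, inv_mul_cancel₀ (neg_ne_zero.mpr ha), Polynomial.C_1]
  rw [mul_add, this, inv_neg, Polynomial.C_neg]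
  ring

namespace DiagramAutomorphism

variable {B : LieAlgebra.Basis ι H} (D : DiagramAutomorphism B)

/-- The order `m` of `σ`. -/
def m : ℕ := orderOf D.perm

lemma map_h (i : ι) : D.σ (B.h i) = B.h (D.perm i) := by
  rw [← (B.sl2 i).lie_e_f, LieEquiv.map_lie, D.map_e, D.map_f, (B.sl2 _).lie_e_f]

lemma zeta_zpow_of_dvd {ε : ℤ} (h : (D.m : ℤ) ∣ ε) : D.ζ ^ ε = 1 :=
  (D.isPrimitiveRoot.zpow_eq_one_iff_dvd ε).mpr h

lemma perm_pow_m (i : ι) : (D.perm ^ D.m) i = i := by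
  rw [m, pow_orderOf_eq_one]; rfl

/-- The automorphism `x ⊗ t^k ↦ ζ^k σ(x) ⊗ t^k` of the loop algebra. -/
def loopAut : LieAlgebra.loopAlgebra ℂ ℤ L →ₗ⁅ℂ⁆ LieAlgebra.loopAlgebra ℂ ℤ L :=
  LieAlgebra.ExtendScalars.map (rescale D.ζ) D.σ.toLieHom

lemma loopAut_tens (x : L) (k : ℤ) :
    D.loopAut (tens x k) = ((D.ζ ^ k : ℂˣ) : ℂ) • tens (D.σ x) k := by
  rw [loopAut, tens, LieAlgebra.ExtendScalars.map_apply_tmul, tens, TensorProduct.smul_tmul']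
  congr 1
  rw [rescale, AddMonoidAlgebra.lift_single, AddMonoidAlgebra.smul_single]
  simp only [MonoidHom.coe_mk, OneHom.coe_mk, toAdd_ofAdd, one_smul, smul_eq_mul, mul_one]

/-- The twisted loop algebra `L^σ(𝔤)`: the fixed points of `loopAut` in `𝔤 ⊗ ℂ[t, t⁻¹]`. -/
def twistedLoop : LieSubalgebra ℂ (LieAlgebra.loopAlgebra ℂ ℤ L) where
  carrier := {x | D.loopAut x = x}
  zero_mem' := D.loopAut.map_zero
  add_mem' := fun {x y} (hx : D.loopAut x = x) (hy : D.loopAut y = y) => by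
    change D.loopAut (x + y) = x + y
    rw [map_add, hx, hy]
  smul_mem' := fun c x (hx : D.loopAut x = x) => by
    change D.loopAut (c • x) = c • x
    rw [map_smul, hx]
  lie_mem' := fun {x y} (hx : D.loopAut x = x) (hy : D.loopAut y = y) => by
    change D.loopAut ⁅x, y⁆ = ⁅x, y⁆
    rw [LieHom.map_lie, hx, hy]

/-- The element `x ⊗ t^k` of `L^σ(𝔤)`, for `x ∈ 𝔤_ε`, `ε ≡ -k` modulo `m`. -/
def twTens (x : L) (k : ℤ) (hx : D.σ x = ((D.ζ ^ (-k) : ℂˣ) : ℂ) • x) : D.twistedLoop :=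
  ⟨tens x k, by
    change D.loopAut (tens x k) = tens x k
    rw [loopAut_tens, hx, tens, TensorProduct.tmul_smul, smul_smul, ← Units.val_mul,
      ← zpow_add, add_neg_cancel, zpow_zero, Units.val_one, one_smul, tens]⟩

/-- The node `i` is fixed by `σ` (if no node is joined to its image, this means that the simple
root of `𝔤₀` attached to `i` is long). -/
def IsFixed (i : ι) : Prop := D.perm i = i

/-- The node `i` is joined to its image under `σ` by an edge of the Dynkin diagram. Such a node
exists exactly when `𝔤` has type `A_{2n}`; then it is one of the two middle nodes `n`, `n + 1`, so
that exactly one element of `I₀` has this property. -/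
def IsMiddle (i : ι) : Prop := B.A i (D.perm i) = -1

open Classical in
/-- The element `y_{i,ε}` made from `y = (y_i)`, without the special factors for the middle
node: `y_{i,ε} = ∑_{j < m} ζ^{-jε} y_{σ^j i}` if `σ i ≠ i`, and, if `σ i = i`, `y_{i,0} = y_i` and
`y_{i,ε} = 0` for `ε ≢ 0` modulo `m`. -/
def comp (y : ι → L) (i : ι) (ε : ℤ) : L :=
  if D.IsFixed i then (if (D.m : ℤ) ∣ ε then y i else 0)
  else ∑ j ∈ Finset.range D.m, ((D.ζ ^ (-(j * ε)) : ℂˣ) : ℂ) • y ((D.perm ^ j) i)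

/-- The element `y_{i,ε}` lies in `𝔤_ε`. -/
lemma map_comp {y : ι → L} (hy : ∀ i, D.σ (y i) = y (D.perm i)) (i : ι) (ε : ℤ) :
    D.σ (D.comp y i ε) = ((D.ζ ^ ε : ℂˣ) : ℂ) • D.comp y i ε := by
  unfold comp
  split_ifs with h1 h2
  · rw [hy, h1, D.zeta_zpow_of_dvd h2, Units.val_one, one_smul]
  · simp
  · set g : ℕ → L := fun j => ((D.ζ ^ (-(j * ε)) : ℂˣ) : ℂ) • y ((D.perm ^ j) i) with hg
    have hstep (j : ℕ) : D.σ (g j) = ((D.ζ ^ ε : ℂˣ) : ℂ) • g (j + 1) := by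
      simp only [hg]
      rw [map_smul, hy, smul_smul, ← Units.val_mul, ← zpow_add, pow_succ',
        Equiv.Perm.mul_apply]
      congr 3
      push_cast; ring
    have hend : g D.m = g 0 := by
      simp only [hg]
      rw [D.zeta_zpow_of_dvd (ε := -((D.m : ℤ) * ε)) (Dvd.dvd.neg_right (dvd_mul_right _ _)),
        D.perm_pow_m]
      simp
    have hsum : D.σ (∑ j ∈ Finset.range D.m, g j)
        = ∑ j ∈ Finset.range D.m, D.σ (g j) := map_sum D.σ.toLinearEquiv _ _
    change D.σ (∑ j ∈ Finset.range D.m, g j) = _ • ∑ j ∈ Finset.range D.m, g j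
    rw [hsum, Finset.sum_congr rfl fun j _ => hstep j, ← Finset.smul_sum]
    congr 1
    have h3 := Finset.sum_range_succ g D.m
    rw [Finset.sum_range_succ', hend] at h3
    exact add_right_cancel h3

open Classical in
/-- The element `h_{i,ε}`; at the middle node of `A_{2n}`, `h_{n,0} = 2 (h_n + h_{n+1})` and
`h_{n,1} = h_n - h_{n+1}`. -/
def hComp (i : ι) (ε : ℤ) : L :=
  if D.IsMiddle i ∧ (D.m : ℤ) ∣ ε then (2 : ℂ) • D.comp B.h i ε else D.comp B.h i ε

lemma map_hComp (i : ι) (ε : ℤ) :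
    D.σ (D.hComp i ε) = ((D.ζ ^ ε : ℂˣ) : ℂ) • D.hComp i ε := by
  unfold hComp
  split_ifs
  · rw [map_smul, D.map_comp D.map_h, smul_comm]
  · exact D.map_comp D.map_h i ε

open Classical in
/-- The element `x⁻_{i,0}`; at the middle node of `A_{2n}`,
`x⁻_{n,0} = √2 (x⁻_n + x⁻_{n+1})`. -/
def xMinus (i : ι) : L :=
  if D.IsMiddle i then ((Real.sqrt 2 : ℝ) : ℂ) • D.comp B.f i 0 else D.comp B.f i 0

lemma map_xMinus (i : ι) : D.σ (D.xMinus i) = ((D.ζ ^ (-0 : ℤ) : ℂˣ) : ℂ) • D.xMinus i := by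
  have h := D.map_comp D.map_f i 0
  rw [zpow_zero, Units.val_one, one_smul] at h
  rw [neg_zero, zpow_zero, Units.val_one, one_smul]
  unfold xMinus
  split_ifs
  · rw [map_smul, h]
  · exact h

/-- The element `h_{i,ε} ⊗ t^r` of `L^σ(𝔤)`, where `ε ≡ -r` modulo `m`; that is,
`h_{i,ε} ⊗ t^{mk - ε}` for `r = mk - ε`. -/
def hLoop (i : ι) (r : ℤ) : D.twistedLoop := D.twTens (D.hComp i (-r)) r (D.map_hComp i (-r))

/-- The element `x⁻_{i,0} ⊗ 1` of `L^σ(𝔤)`. -/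
def xMinusLoop (i : ι) : D.twistedLoop := D.twTens (D.xMinus i) 0 (D.map_xMinus i)

/-- The enveloping algebra of `L^σ(𝔤)`. -/
abbrev U : Type _ := UniversalEnvelopingAlgebra ℂ D.twistedLoop

/-- The inclusion of `L^σ(𝔤)` in its enveloping algebra. -/
abbrev toU (x : D.twistedLoop) : D.U := UniversalEnvelopingAlgebra.ι ℂ x

open Classical in
/-- The exponent in the series `P^±_{i,σ}(u)`, with `s = 1` for `P^+` and `s = -1` for `P^-`:
* if `i` is fixed by `σ`: `-∑_{k ≥ 1} (h_{i,0} ⊗ t^{± m k}) / k u^k`;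
* if `i = n` is the middle node of `A_{2n}`:
  `-∑_{k ≥ 1} (h_{n,0}/2 ⊗ t^{± 2k}) / (2k) u^{2k} + ∑_{k ≥ 1} (h_{n,1} ⊗ t^{± (2k-1)}) / (2k-1) u^{2k-1}`;
* otherwise: `-∑_{r ≥ 1} (h_{i,ε} ⊗ t^{± r}) / r u^r`, with `ε ≡ ∓ r` modulo `m`. -/
def logSeries (s : ℤ) (i : ι) : PowerSeries D.U :=
  PowerSeries.mk fun r =>
    if r = 0 then 0
    else if D.IsFixed i then (-(r : ℂ)⁻¹) • D.toU (D.hLoop i (s * (D.m * r)))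
    else if D.IsMiddle i then
      if Even r then (-(r : ℂ)⁻¹) • ((2 : ℂ)⁻¹ • D.toU (D.hLoop i (s * r)))
      else ((r : ℂ)⁻¹) • D.toU (D.hLoop i (s * r))
    else (-(r : ℂ)⁻¹) • D.toU (D.hLoop i (s * r))

/-- The series `P^+_{i,σ}(u)` (`s = 1`) and `P^-_{i,σ}(u)` (`s = -1`). -/
def pSeries (s : ℤ) (i : ι) : PowerSeries D.U := expSeries (D.logSeries s i)

/-- The set `P_σ^+` of dominant integral weights of `𝔤₀` with `λ(h_{n,0})` even if `𝔤` has type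
`A_{2n}`. A weight is given by its coordinates `λ(h_{i,0})`, `i ∈ I₀`, in the basis of
fundamental weights. -/
def dominantWeights : Set (D.I₀ → ℕ) := {lam | ∀ i : D.I₀, D.IsMiddle i → Even (lam i)}

open Classical in
/-- The tuple `π^σ_{λ,a}`. Its entry at `i` is `(1 - a^m u)^{λ(h_{i,0})}` if `σ i = i`,
`(1 - a u)^{λ(h_{n,0})/2}` if `i = n` is the middle node of `A_{2n}`, and
`(1 - a u)^{λ(h_{i,0})}` otherwise. -/
def piTuple (lam : D.I₀ → ℕ) (a : ℂ) : D.I₀ → ℂ[X] := fun i =>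
  (1 - Polynomial.C (if D.IsFixed i then a ^ D.m else a) * Polynomial.X) ^
    (if D.IsMiddle i then lam i / 2 else lam i)

/-- The monoid `𝒫_σ^+` generated by the tuples `π^σ_{λ,a}`, `λ ∈ P_σ^+`, `a ≠ 0`. -/
def polyMonoid : Submonoid (D.I₀ → ℂ[X]) :=
  Submonoid.closure {p | ∃ lam ∈ D.dominantWeights, ∃ a : ℂ, a ≠ 0 ∧ p = D.piTuple lam a}

open Classical in
/-- The coordinates `λ_π(h_{i,0})` of the weight `λ_π`: the degree of `π_i`, doubled at the middle
node of `A_{2n}`. -/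
def weight (p : D.I₀ → ℂ[X]) (i : D.I₀) : ℕ :=
  if D.IsMiddle i then 2 * (p i).natDegree else (p i).natDegree

/-- The subspace `𝔫⁺ ⊗ ℂ[t, t⁻¹]` of the loop algebra. -/
def loopNPlus : Submodule ℂ (LieAlgebra.loopAlgebra ℂ ℤ L) :=
  Submodule.span ℂ {z | ∃ y ∈ B.borelUpper, ∃ k : ℤ, z = tens y k}

/-- The elements of the enveloping algebra that annihilate the generator `w` of `W(π)`. The
elements `h_{i,0}`, `i ∈ I₀`, are a basis of `𝔥₀`. -/
inductive WeylRelation (p : D.I₀ → ℂ[X]) : D.U → Prop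
  /-- `L^σ(𝔫⁺) w = 0` -/
  | nPlus (x : D.twistedLoop)
      (hx : (x : LieAlgebra.loopAlgebra ℂ ℤ L) ∈ loopNPlus (B := B)) :
      WeylRelation p (D.toU x)
  /-- `h w = λ_π(h) w` for `h = h_{i,0}` -/
  | cartan (i : D.I₀) :
      WeylRelation p (D.toU (D.hLoop i 0) - algebraMap ℂ D.U (D.weight p i))
  /-- `(x⁻_{i,0})^{λ_π(h_{i,0}) + 1} w = 0` -/
  | xMinus (i : D.I₀) :
      WeylRelation p (D.toU (D.xMinusLoop i) ^ (D.weight p i + 1))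
  /-- `(P^+_{i,σ}(u) - π_i(u)) w = 0` -/
  | pPlus (i : D.I₀) (k : ℕ) :
      WeylRelation p
        (PowerSeries.coeff k (D.pSeries 1 i) - algebraMap ℂ D.U ((p i).coeff k))
  /-- `(P^-_{i,σ}(u) - π_i^-(u)) w = 0` -/
  | pMinus (i : D.I₀) (k : ℕ) :
      WeylRelation p
        (PowerSeries.coeff k (D.pSeries (-1) i) - algebraMap ℂ D.U ((minus (p i)).coeff k))

/-- The twisted Weyl module `W(π)`: the module over the enveloping algebra of `L^σ(𝔤)` with one
generator and the relations `WeylRelation`, that is, the quotient of the enveloping algebra by the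
left ideal generated by them. -/
abbrev WeylModule (p : D.I₀ → ℂ[X]) : Type _ :=
  D.U ⧸ Submodule.span D.U {x | D.WeylRelation p x}

end DiagramAutomorphism
end TwistedLoop

end

/-! The proof has two halves: the twisted loop algebra acts on the Weyl module through a
finite-dimensional Lie algebra, and that Lie algebra is spanned by elements acting locally
nilpotently.

For the first half, the relations on the series `pSeries` say that on the generator `w` the loops on
`h_i` act by power sums of the inverse roots of `π_i`, up to a factor periodic in the degree. As
functions of the degree these eigenvalues satisfy a linear recurrence, so some nonzero polynomial
`b` in `t^{2m}` makes every `b`-multiple of the loops on `h_i` kill `w`. If `f_i^{n+1} w = 0` in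
degree zero, applying the `b`-multiple of `e_i` to it `n` times gives `(b^n f_i) w = 0`
(`lowering_pow_apply_eq_zero`, a weak form of Garland's identity). The elements of `L` whose loops
on `w` are recurrent form a subalgebra containing the Chevalley generators, hence are all of `L`. A
common `b` then works for all of `L`; the `b`-multiples form an ideal, so they kill the whole module
(`IsWeylGenerator.exists_polyLoop_lie_eq_zero`), and the image in the endomorphisms has finite
dimension.

For the second half, exponentials show that the span of the locally nilpotent elements is a
subalgebra (`nilSpan`). It contains the loops on `e_k`, which kill `w`, and the degree-zero `f_i`,
which are nilpotent on `w`. These generate everything (`IsWeylGenerator.mem_nilSpan`). A filtration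
argument with the pigeonhole principle, `finite_of_pow_apply_eq_zero`, finishes the proof.

No classification is used: the middle node of `A_{2n}` differs only in the scalars of the relations,
and the one number that has to be nonzero is handled by a trace argument in `orbitSum_self_ne_zero`.
-/

namespace TwistedLoop

/-! ### Exponentials of locally nilpotent operators, and the subalgebra they give. -/

section LocallyNilpotent

variable {K V : Type*} [Field K] [AddCommGroup V] [Module K V]

/-- An endomorphism is locally nilpotent if every vector is annihilated by one of its powers. -/
def IsLocallyNilpotent (f : Module.End K V) : Prop := ∀ v, ∃ n : ℕ, (f ^ n) v = 0

/-- The truncated exponential series. -/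
def expSum (f : Module.End K V) (N : ℕ) : Module.End K V :=
  ∑ n ∈ Finset.range N, ((n.factorial : K)⁻¹) • f ^ n

lemma expSum_apply (f : Module.End K V) (N : ℕ) (v : V) :
    expSum f N v = ∑ n ∈ Finset.range N, ((n.factorial : K)⁻¹) • (f ^ n) v := by
  simp [expSum, LinearMap.sum_apply]

lemma pow_apply_eq_zero_of_le {f : Module.End K V} {m n : ℕ} (hmn : m ≤ n) {v : V}
    (h : (f ^ m) v = 0) : (f ^ n) v = 0 := by
  obtain ⟨k, rfl⟩ := Nat.exists_eq_add_of_le hmn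
  rw [add_comm, pow_add, Module.End.mul_apply, h, map_zero]

lemma expSum_eq_of_le {f : Module.End K V} {m n : ℕ} (hmn : m ≤ n) {v : V}
    (h : (f ^ m) v = 0) : expSum f n v = expSum f m v := by
  rw [expSum_apply, expSum_apply]
  symm
  apply Finset.sum_subset (Finset.range_mono hmn)
  intro k _ hk
  rw [pow_apply_eq_zero_of_le (by simpa using hk) h, smul_zero]

lemma expSum_eq {f : Module.End K V} {m n : ℕ} {v : V}
    (hm : (f ^ m) v = 0) (hn : (f ^ n) v = 0) : expSum f n v = expSum f m v := by
  rw [← expSum_eq_of_le (le_max_left m n) hm, ← expSum_eq_of_le (le_max_right m n) hn]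

open Classical in
/-- The exponential of a locally nilpotent endomorphism. -/
noncomputable def locExp (f : Module.End K V) (hf : IsLocallyNilpotent f) : Module.End K V where
  toFun v := expSum f (Nat.find (hf v)) v
  map_add' u v := by
    obtain ⟨a, ha⟩ := hf u
    obtain ⟨b, hb⟩ := hf v
    have ha' := pow_apply_eq_zero_of_le (le_max_left a b) ha
    have hb' := pow_apply_eq_zero_of_le (le_max_right a b) hb
    rw [expSum_eq ha' (Nat.find_spec (hf u)), expSum_eq hb' (Nat.find_spec (hf v)), ← map_add]
    exact expSum_eq (by rw [map_add, ha', hb', add_zero]) (Nat.find_spec (hf (u + v)))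
  map_smul' c v := by
    have h := Nat.find_spec (hf v)
    rw [RingHom.id_apply, ← map_smul]
    exact expSum_eq (by rw [map_smul, h, smul_zero]) (Nat.find_spec (hf (c • v)))

open Classical in
lemma locExp_apply {f : Module.End K V} (hf : IsLocallyNilpotent f) {n : ℕ} {v : V}
    (h : (f ^ n) v = 0) : locExp f hf v = expSum f n v :=
  expSum_eq h (Nat.find_spec (hf v))

/-- Every term of `exp(f) v - v` contains a factor `f`, so this difference is killed by a smaller
power of `f` than `v`; induct on that power. -/
lemma locExp_surjective {f : Module.End K V} (hf : IsLocallyNilpotent f) :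
    Function.Surjective (locExp f hf) := by
  suffices H : ∀ n v, (f ^ n) v = 0 → v ∈ LinearMap.range (locExp f hf) by
    intro v
    obtain ⟨n, hn⟩ := hf v
    exact H n v hn
  intro n
  induction n with
  | zero => intro v hv; rw [pow_zero, Module.End.one_apply] at hv; rw [hv]; exact zero_mem _
  | succ n ih =>
    intro v hv
    have h1 : locExp f hf v - v ∈ LinearMap.range (locExp f hf) := by
      apply ih
      rw [locExp_apply hf hv, expSum_apply, Finset.sum_range_succ']
      simp only [Nat.factorial_zero, Nat.cast_one, inv_one, pow_zero, Module.End.one_apply,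
        one_smul, add_sub_cancel_right, map_sum, map_smul]
      apply Finset.sum_eq_zero
      intro k _
      rw [← Module.End.mul_apply, ← pow_add,
        pow_apply_eq_zero_of_le (show n + 1 ≤ n + (k + 1) by omega) hv, smul_zero]
    have h2 := sub_mem (LinearMap.mem_range_self (locExp f hf) v) h1
    rwa [sub_sub_cancel] at h2

/-- A functional vanishing on `S` turns the curve into a polynomial with infinitely many zeros, so
it vanishes on each coefficient. This replaces differentiation at `s = 0`. -/
lemma mem_of_forall_sum_pow_smul_mem [Infinite K] (S : Submodule K V) (n : ℕ) (z : ℕ → V)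
    (h : ∀ s : K, ∑ k ∈ Finset.range n, s ^ k • z k ∈ S) {k : ℕ} (hk : k < n) : z k ∈ S := by
  by_contra hz
  obtain ⟨φ, hφ, hS⟩ := Submodule.exists_le_ker_of_notMem hz
  apply hφ
  set P : Polynomial K := ∑ k ∈ Finset.range n, Polynomial.monomial k (φ (z k)) with hP
  have h0 : P = 0 := by
    apply Polynomial.funext
    intro s
    have := hS (h s)
    rw [LinearMap.mem_ker, map_sum] at this
    simp only [hP, Polynomial.eval_finsetSum, Polynomial.eval_monomial, Polynomial.eval_zero]
    rw [← this]
    exact Finset.sum_congr rfl fun k _ => by rw [map_smul, smul_eq_mul, mul_comm]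
  have h1 : P.coeff k = φ (z k) := by
    simp [hP, Polynomial.finsetSum_coeff, Polynomial.coeff_monomial, hk]
  rw [← h1, h0, Polynomial.coeff_zero]

lemma IsLocallyNilpotent.smul {f : Module.End K V} (hf : IsLocallyNilpotent f) (c : K) :
    IsLocallyNilpotent (c • f) := by
  intro v
  obtain ⟨n, hn⟩ := hf v
  exact ⟨n, by rw [smul_pow, LinearMap.smul_apply, hn, smul_zero]⟩

variable [CharZero K] {A : Type*} [LieRing A] [LieAlgebra K A] [LieRingModule A V]
  [LieModule K A V]

open LieModule LieAlgebra

/-- The Leibniz rule for divided powers. Truncating at `a + b` loses nothing, because the nonzero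
terms have indices in the box `a × b`. -/
lemma expSum_lie {x y : A} {v : V} {a b : ℕ} (ha : ((ad K A x) ^ a) y = 0)
    (hb : ((toEnd K A V x) ^ b) v = 0) :
    expSum (toEnd K A V x) (a + b) ⁅y, v⁆ =
      ⁅expSum (ad K A x) a y, expSum (toEnd K A V x) b v⁆ := by
  set g : ℕ × ℕ → V := fun p => ((p.1.factorial : K)⁻¹ * (p.2.factorial : K)⁻¹) •
    ⁅((ad K A x) ^ p.1) y, ((toEnd K A V x) ^ p.2) v⁆ with hg
  have hg0 : ∀ p : ℕ × ℕ, ¬ (p.1 < a ∧ p.2 < b) → g p = 0 := by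
    intro p hp
    rcases not_and_or.mp hp with h | h
    · simp only [hg, pow_apply_eq_zero_of_le (not_lt.mp h) ha, zero_lie, smul_zero]
    · simp only [hg, pow_apply_eq_zero_of_le (not_lt.mp h) hb, lie_zero, smul_zero]
  have h1 : ⁅expSum (ad K A x) a y, expSum (toEnd K A V x) b v⁆ =
      ∑ p ∈ Finset.range a ×ˢ Finset.range b, g p := by
    rw [expSum_apply, expSum_apply, sum_lie, Finset.sum_product]
    refine Finset.sum_congr rfl fun i _ => ?_
    rw [lie_sum]
    refine Finset.sum_congr rfl fun j _ => ?_
    rw [smul_lie, lie_smul, smul_smul]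
  have h2 : expSum (toEnd K A V x) (a + b) ⁅y, v⁆ =
      ∑ n ∈ Finset.range (a + b), ∑ p ∈ Finset.HasAntidiagonal.antidiagonal n, g p := by
    rw [expSum_apply]
    refine Finset.sum_congr rfl fun n _ => ?_
    rw [toEnd_pow_lie, Finset.smul_sum]
    refine Finset.sum_congr rfl fun p hp => ?_
    rw [← Nat.cast_smul_eq_nsmul K, smul_smul]
    simp only [hg]
    congr 1
    rw [← Finset.HasAntidiagonal.mem_antidiagonal.mp hp, Nat.cast_add_choose]
    have := Nat.factorial_ne_zero (p.1 + p.2)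
    have := Nat.factorial_ne_zero p.1
    have := Nat.factorial_ne_zero p.2
    field_simp
  rw [h1, h2, Finset.sum_sigma']
  -- The triangle of antidiagonals and the box differ only in terms that vanish, so the match is
  -- needed on nonzero terms alone.
  refine Finset.sum_bij_ne_zero (fun s _ _ => s.2) ?_ ?_ ?_ ?_
  · intro s _ hs
    by_contra hcon
    exact hs (hg0 _ (by simpa using hcon))
  · rintro ⟨n, p⟩ h1 _ ⟨n', p'⟩ h2 _ h
    simp only [Finset.mem_sigma, Finset.HasAntidiagonal.mem_antidiagonal] at h1 h2
    obtain rfl : p = p' := h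
    obtain rfl : n = n' := by rw [← h1.2, ← h2.2]
    rfl
  · intro p hp hp0
    simp only [Finset.mem_product, Finset.mem_range] at hp
    exact ⟨⟨p.1 + p.2, p⟩, by simp; omega, hp0, rfl⟩
  · intro s _ _; rfl

lemma locExp_lie {x : A} (hA : IsLocallyNilpotent (ad K A x))
    (hV : IsLocallyNilpotent (toEnd K A V x)) (y : A) (v : V) :
    locExp _ hV ⁅y, v⁆ = ⁅locExp _ hA y, locExp _ hV v⁆ := by
  obtain ⟨a, ha⟩ := hA y
  obtain ⟨b, hb⟩ := hV v
  rw [locExp_apply hA ha, locExp_apply hV hb, ← expSum_lie ha hb]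
  apply locExp_apply
  rw [toEnd_pow_lie]
  refine Finset.sum_eq_zero fun p hp => ?_
  rw [Finset.HasAntidiagonal.mem_antidiagonal] at hp
  rcases lt_or_ge p.1 a with h | h
  · rw [pow_apply_eq_zero_of_le (by omega) hb, lie_zero, smul_zero]
  · rw [pow_apply_eq_zero_of_le h ha, zero_lie, smul_zero]

/-- The operator `exp(x)` intertwines `y` with `exp(ad x) y`. Since it is surjective, local
nilpotency is transported; its inverse is not needed. -/
lemma isLocallyNilpotent_locExp {x : A} (hA : IsLocallyNilpotent (ad K A x))
    (hV : IsLocallyNilpotent (toEnd K A V x)) {y : A}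
    (hy : IsLocallyNilpotent (toEnd K A V y)) :
    IsLocallyNilpotent (toEnd K A V (locExp _ hA y)) := by
  intro v
  obtain ⟨u, rfl⟩ := locExp_surjective hV v
  obtain ⟨n, hn⟩ := hy u
  refine ⟨n, ?_⟩
  have key : ∀ n, ((toEnd K A V (locExp _ hA y)) ^ n) (locExp _ hV u) =
      locExp _ hV (((toEnd K A V y) ^ n) u) := by
    intro n
    induction n with
    | zero => simp
    | succ n ih =>
      rw [pow_succ', Module.End.mul_apply, ih, toEnd_apply_apply, ← locExp_lie, pow_succ',
        Module.End.mul_apply, toEnd_apply_apply]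
  rw [key, hn, map_zero]

variable (K V A) in
/-- The elements that act locally nilpotently, on the Lie algebra and on a module. -/
def nilElements : Set A :=
  {x | IsLocallyNilpotent (ad K A x) ∧ IsLocallyNilpotent (toEnd K A V x)}

/-- The curve `s ↦ exp(s ad x) y` stays among the locally nilpotent elements, and `⁅x, y⁆` is its
coefficient at `s`. -/
lemma lie_mem_span_nilElements {x y : A} (hx : x ∈ nilElements K V A)
    (hy : y ∈ nilElements K V A) : ⁅x, y⁆ ∈ Submodule.span K (nilElements K V A) := by
  obtain ⟨n, hn⟩ := hx.1 y
  -- The bound `n + 2` keeps the index `1` in range even for `n = 0`.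
  have h := mem_of_forall_sum_pow_smul_mem (Submodule.span K (nilElements K V A)) (n + 2)
    (fun k => ((k.factorial : K)⁻¹) • ((ad K A x) ^ k) y) ?_ (show 1 < n + 2 by omega)
  · simpa using h
  intro s
  have hA : IsLocallyNilpotent (ad K A (s • x)) := by rw [map_smul]; exact hx.1.smul s
  have hV : IsLocallyNilpotent (toEnd K A V (s • x)) := by rw [map_smul]; exact hx.2.smul s
  have h0 : ((ad K A (s • x)) ^ (n + 2)) y = 0 := by
    rw [map_smul, smul_pow, LinearMap.smul_apply, pow_apply_eq_zero_of_le (by omega) hn, smul_zero]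
  have h1 : ∑ k ∈ Finset.range (n + 2), s ^ k • ((k.factorial : K)⁻¹) • ((ad K A x) ^ k) y =
      locExp _ hA y := by
    rw [locExp_apply hA h0, expSum_apply]
    refine Finset.sum_congr rfl fun k _ => ?_
    rw [map_smul, smul_pow, LinearMap.smul_apply, smul_comm]
  rw [h1]
  exact Submodule.subset_span
    ⟨isLocallyNilpotent_locExp hA hA hy.1, isLocallyNilpotent_locExp hA hV hy.2⟩

variable (K V A) in
/-- The span of the elements that act locally nilpotently, as a subalgebra. -/
def nilSpan : LieSubalgebra K A where
  __ := Submodule.span K (nilElements K V A)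
  lie_mem' {x y} hx hy := by
    change x ∈ Submodule.span K (nilElements K V A) at hx
    change y ∈ Submodule.span K (nilElements K V A) at hy
    change ⁅x, y⁆ ∈ Submodule.span K (nilElements K V A)
    induction hx using Submodule.span_induction with
    | zero => rw [zero_lie]; exact zero_mem _
    | add u v _ _ hu hv => rw [add_lie]; exact add_mem hu hv
    | smul c u _ hu => rw [smul_lie]; exact Submodule.smul_mem _ c hu
    | mem x hx =>
      induction hy using Submodule.span_induction with
      | zero => rw [lie_zero]; exact zero_mem _
      | add u v _ _ hu hv => rw [lie_add]; exact add_mem hu hv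
      | smul c u _ hu => rw [lie_smul]; exact Submodule.smul_mem _ c hu
      | mem y hy => exact lie_mem_span_nilElements hx hy

end LocallyNilpotent

end TwistedLoop

noncomputable section
namespace TwistedLoop

/-! ### Finite-dimensionality of cyclic modules by a filtration by word length. -/

section Finiteness

variable {K V A κ : Type*} [Field K] [AddCommGroup V] [Module K V]
  [LieRing A] [LieRingModule A V] (y : κ → A) (w : V)

open LieModule

/-- The vector `y_{i₁} ⋯ y_{iₙ} w` for the word `i₁ … iₙ`. -/
def wordAct (l : List κ) : V := l.foldr (fun i v => ⁅y i, v⁆) w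

variable (K) in
/-- The span of the vectors `y_{i₁} ⋯ y_{iₖ} w` with `k ≤ n`. -/
def wordSpan (n : ℕ) : Submodule K V :=
  Submodule.span K (wordAct y w '' {l : List κ | l.length ≤ n})

variable {y w}

lemma wordAct_mem_wordSpan {l : List κ} {n : ℕ} (h : l.length ≤ n) :
    wordAct y w l ∈ wordSpan K y w n :=
  Submodule.subset_span ⟨l, h, rfl⟩

variable [LieAlgebra K A] [LieModule K A V]

lemma lie_mem_wordSpan (hy : Submodule.span K (Set.range y) = ⊤) (x : A) {n : ℕ} {v : V}
    (hv : v ∈ wordSpan K y w n) : ⁅x, v⁆ ∈ wordSpan K y w (n + 1) := by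
  have hx : x ∈ Submodule.span K (Set.range y) := hy ▸ Submodule.mem_top
  induction hx using Submodule.span_induction with
  | zero => rw [zero_lie]; exact zero_mem _
  | add u v _ _ hu hv => rw [add_lie]; exact add_mem hu hv
  | smul c u _ hu => rw [smul_lie]; exact Submodule.smul_mem _ c hu
  | mem x hx =>
    obtain ⟨i, rfl⟩ := hx
    induction hv using Submodule.span_induction with
    | zero => rw [lie_zero]; exact zero_mem _
    | add u v _ _ hu hv => rw [lie_add]; exact add_mem hu hv
    | smul c u _ hu => rw [lie_smul]; exact Submodule.smul_mem _ c hu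
    | mem v hv =>
      obtain ⟨l, hl, rfl⟩ := hv
      exact wordAct_mem_wordSpan (l := i :: l) (by simpa using hl)

/-- Exchanging adjacent letters costs their bracket, which is again a combination of single letters
because they span; the error is thus a combination of shorter words. -/
lemma wordAct_sub_mem_of_perm (hy : Submodule.span K (Set.range y) = ⊤) {l l' : List κ}
    (h : l.Perm l') : ∀ n, l.length ≤ n + 1 →
      wordAct y w l - wordAct y w l' ∈ wordSpan K y w n := by
  induction h with
  | nil => intro n _; rw [sub_self]; exact zero_mem _
  | @cons i l l' h ih =>
    intro n hn
    cases n with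
    | zero =>
      have hl : l = [] := by simpa using hn
      subst hl
      rw [List.nil_perm.mp h, sub_self]
      exact zero_mem _
    | succ n =>
      have := lie_mem_wordSpan hy (y i) (ih n (by simpa using hn))
      rwa [lie_sub] at this
  | swap i j l =>
    intro n hn
    obtain ⟨n, rfl⟩ : ∃ k, n = k + 1 := ⟨n - 1, by simp at hn; omega⟩
    have := lie_mem_wordSpan hy ⁅y j, y i⁆ (wordAct_mem_wordSpan (K := K) (y := y) (w := w)
      (show l.length ≤ n by simpa using hn))
    rwa [lie_lie] at this
  | trans h1 _ ih1 ih2 =>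
    intro n hn
    have := add_mem (ih1 n hn) (ih2 n (h1.length_eq ▸ hn))
    rwa [sub_add_sub_cancel] at this

lemma wordAct_append_replicate {i : κ} {k : ℕ} (h : ((toEnd K A V (y i)) ^ k) w = 0)
    (l : List κ) : wordAct y w (l ++ List.replicate k i) = 0 := by
  have h1 : ∀ k, wordAct y w (List.replicate k i) = ((toEnd K A V (y i)) ^ k) w := by
    intro k
    induction k with
    | zero => rfl
    | succ k ih =>
      rw [List.replicate_succ, pow_succ', Module.End.mul_apply, ← ih]
      rfl
  induction l with
  | nil => rw [List.nil_append, h1, h]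
  | cons j l ih =>
    change ⁅y j, wordAct y w (l ++ List.replicate k i)⁆ = 0
    rw [ih, lie_zero]

/-- By the pigeonhole principle a word this long repeats some letter `k` times. Moving these copies
to the right end, next to `w`, gives zero modulo shorter words. -/
lemma wordAct_mem_of_card_mul_lt [Fintype κ] (hy : Submodule.span K (Set.range y) = ⊤) {k : ℕ}
    (h : ∀ i, ((toEnd K A V (y i)) ^ k) w = 0) {n : ℕ} (hn : Fintype.card κ * k ≤ n)
    {l : List κ} (hl : l.length ≤ n + 1) : wordAct y w l ∈ wordSpan K y w n := by
  classical
  rcases Nat.lt_or_ge l.length (n + 1) with h1 | h1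
  · exact wordAct_mem_wordSpan (by omega)
  obtain ⟨i, hi⟩ : ∃ i, k ≤ l.count i := by
    by_contra! hcon
    have h2 : l.length = ∑ i, l.count i := by
      rw [← Multiset.coe_card, ← Multiset.sum_count_eq_card (s := Finset.univ) (by simp)]
      simp
    have h3 : ∑ i, l.count i ≤ ∑ _i : κ, k := Finset.sum_le_sum fun i _ => (hcon i).le
    simp only [Finset.sum_const, Finset.card_univ, smul_eq_mul] at h3
    omega
  obtain ⟨l', hl'⟩ := (List.replicate_sublist_iff.mpr hi).exists_perm_append
  have h4 := wordAct_sub_mem_of_perm (w := w) hy (hl'.trans List.perm_append_comm) n hl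
  rwa [wordAct_append_replicate (h i), sub_zero] at h4

/-- A cyclic module over a Lie algebra that is spanned by finitely many elements, each of which
acts nilpotently on the generator, has finite dimension. -/
theorem finite_of_pow_apply_eq_zero [Finite κ] (hy : Submodule.span K (Set.range y) = ⊤)
    (h : ∀ i, ∃ k : ℕ, ((toEnd K A V (y i)) ^ k) w = 0)
    (hw : ∀ N : Submodule K V, w ∈ N → (∀ x : A, ∀ v ∈ N, ⁅x, v⁆ ∈ N) → N = ⊤) :
    Module.Finite K V := by
  have := Fintype.ofFinite κ
  choose k hk using h
  set m := ∑ i, k i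
  have hm : ∀ i, ((toEnd K A V (y i)) ^ m) w = 0 := fun i =>
    pow_apply_eq_zero_of_le (Finset.single_le_sum (fun _ _ => Nat.zero_le _)
      (Finset.mem_univ i)) (hk i)
  set n := Fintype.card κ * m
  -- Once the filtration stops growing, its last term is stable under the Lie algebra and contains
  -- `w`, so cyclicity makes it everything.
  have h1 : wordSpan K y w (n + 1) ≤ wordSpan K y w n := by
    refine Submodule.span_le.mpr ?_
    rintro _ ⟨l, hl, rfl⟩
    exact wordAct_mem_of_card_mul_lt hy hm le_rfl hl
  have h2 : wordSpan K y w n = ⊤ := hw _ (wordAct_mem_wordSpan (l := []) (by simp))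
    fun x v hv => h1 (lie_mem_wordSpan hy x hv)
  refine ⟨h2 ▸ Submodule.fg_span ?_⟩
  exact (List.finite_length_le κ n).image _

end Finiteness

/-! ### Raising operators applied to words of lowering operators. -/

section Merge

variable {K V : Type*} [Field K] [AddCommGroup V] [Module K V]

open Polynomial

/-- The words obtained from a word by multiplying one of its letters by `c`. -/
def mulOne {R : Type*} [Mul R] (c : R) : List R → List (List R)
  | [] => []
  | a :: l => (c * a :: l) :: (mulOne c l).map (a :: ·)

/-- The words obtained from a word by replacing two of its letters by their product with `b`. -/
def mergeTwo {R : Type*} [Mul R] (b : R) : List R → List (List R)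
  | [] => []
  | a :: l => mulOne (b * a) l ++ (mergeTwo b l).map (a :: ·)

lemma mem_mulOne {R : Type*} [CommMonoid R] {c : R} : ∀ {l l' : List R}, l' ∈ mulOne c l →
    l'.length = l.length ∧ l'.prod = c * l.prod
  | [], _, h => by simp [mulOne] at h
  | a :: l, l', h => by
    rw [mulOne, List.mem_cons, List.mem_map] at h
    rcases h with rfl | ⟨l'', h, rfl⟩
    · simp [mul_assoc]
    · obtain ⟨h1, h2⟩ := mem_mulOne h
      simp [h1, h2, mul_left_comm]

lemma length_mulOne {R : Type*} [Mul R] (c : R) : ∀ l : List R, (mulOne c l).length = l.length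
  | [] => rfl
  | a :: l => by simp [mulOne, length_mulOne c l]

lemma mem_mergeTwo {R : Type*} [CommMonoid R] {b : R} : ∀ {l l' : List R}, l' ∈ mergeTwo b l →
    l'.length + 1 = l.length ∧ l'.prod = b * l.prod
  | [], _, h => by simp [mergeTwo] at h
  | a :: l, l', h => by
    rw [mergeTwo, List.mem_append, List.mem_map] at h
    rcases h with h | ⟨l'', h, rfl⟩
    · obtain ⟨h1, h2⟩ := mem_mulOne h
      simp [h1, h2, mul_assoc]
    · obtain ⟨h1, h2⟩ := mem_mergeTwo h
      simp [h1, h2, mul_left_comm]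

lemma length_mergeTwo_pos {R : Type*} [Mul R] (b : R) : ∀ l : List R, 2 ≤ l.length →
    0 < (mergeTwo b l).length
  | [], h => by simp at h
  | a :: l, h => by
    rw [mergeTwo, List.length_append, length_mulOne]
    simp at h
    omega

lemma length_mergeTwo_eq {R : Type*} [Mul R] (b : R) : ∀ {l l' : List R}, l.length = l'.length →
    (mergeTwo b l).length = (mergeTwo b l').length
  | [], [], _ => rfl
  | a :: l, a' :: l', h => by
    have h' : l.length = l'.length := by simpa using h
    simp [mergeTwo, length_mulOne, h', length_mergeTwo_eq b h']
  | [], a :: l, h => by simp at h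
  | a :: l, [], h => by simp at h

variable {E F H : K[X] →ₗ[K] Module.End K V} {q : K}
  {w : V} {b : K[X]}

/-- Passing `H` through a letter multiplies that letter, and what reaches `w` dies. -/
lemma cartan_apply_word (hHF : ∀ b c v, H b (F c v) = F c (H b v) - q • F (b * c) v)
    (hw : ∀ c, H (b * c) w = 0) (c : K[X]) : ∀ l : List K[X],
    H (b * c) ((l.map F).prod w) = -q • ((mulOne (b * c) l).map fun l' => (l'.map F).prod w).sum
  | [] => by simp [mulOne, hw]
  | a :: l => by
    rw [List.map_cons, List.prod_cons, Module.End.mul_apply, hHF,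
      cartan_apply_word hHF hw c l, mulOne, List.map_cons, List.sum_cons, List.map_map]
    have h1 : ∀ L : List (List K[X]),
        (L.map ((fun l' => (l'.map F).prod w) ∘ (a :: ·))).sum =
        F a ((L.map fun l' => (l'.map F).prod w).sum) := by
      intro L
      induction L with
      | nil => simp
      | cons l' L ih => simp [ih]
    rw [h1, map_smul, List.map_cons, List.prod_cons, Module.End.mul_apply]
    module

/-- Passing `E b` through a letter `a` leaves `H (b * a)`, which is then absorbed by one of the
later letters. The net effect merges two letters and multiplies the product of the word by `b`. -/
lemma raising_apply_word (hEF : ∀ b c v, E b (F c v) = F c (E b v) + H (b * c) v)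
    (hHF : ∀ b c v, H b (F c v) = F c (H b v) - q • F (b * c) v)
    (hw : ∀ c, H (b * c) w = 0) (hE : E b w = 0) : ∀ l : List K[X],
    E b ((l.map F).prod w) = -q • ((mergeTwo b l).map fun l' => (l'.map F).prod w).sum
  | [] => by simp [mergeTwo, hE]
  | a :: l => by
    rw [List.map_cons, List.prod_cons, Module.End.mul_apply, hEF,
      raising_apply_word hEF hHF hw hE l, cartan_apply_word hHF hw, mergeTwo, List.map_append,
      List.sum_append, List.map_map]
    have h1 : ∀ L : List (List K[X]),
        (L.map ((fun l' => (l'.map F).prod w) ∘ (a :: ·))).sum =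
        F a ((L.map fun l' => (l'.map F).prod w).sum) := by
      intro L
      induction L with
      | nil => simp
      | cons l' L ih => simp [ih]
    rw [h1, map_smul]
    module

/-- Let `E`, `F`, `H` be the loops on an `𝔰𝔩₂`-triple. If `w` is annihilated by `E` and by
the multiples of `b` in `H`, then `F(1)^{n+1} w = 0` implies `F(bⁿ) w = 0`. -/
theorem lowering_pow_apply_eq_zero [CharZero K]
    (hEF : ∀ b c v, E b (F c v) = F c (E b v) + H (b * c) v)
    (hHF : ∀ b c v, H b (F c v) = F c (H b v) - q • F (b * c) v) (hq : q ≠ 0)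
    (hw : ∀ c, H (b * c) w = 0) (hE : E b w = 0) {n : ℕ} (hF : ((F 1) ^ (n + 1)) w = 0) :
    F (b ^ n) w = 0 := by
  -- After `n` merges a word of `n + 1` letters has become one letter, determined by the product.
  -- All contributions carry the same factor `-q` per merge, so nothing cancels in characteristic
  -- zero.
  have key : ∀ n : ℕ, ∃ c : K, c ≠ 0 ∧ ∀ l : List K[X], l.length = n + 1 →
      ((E b) ^ n) ((l.map F).prod w) = c • F (b ^ n * l.prod) w := by
    intro n
    induction n with
    | zero =>
      refine ⟨1, one_ne_zero, fun l hl => ?_⟩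
      obtain ⟨a, rfl⟩ := List.length_eq_one_iff.mp hl
      simp
    | succ n ih =>
      obtain ⟨c, hc, h⟩ := ih
      -- The number of merges depends only on the length, so a constant word serves to define it.
      set N := (mergeTwo b (List.replicate (n + 2) (1 : K[X]))).length with hN
      have hN0 : 0 < N := length_mergeTwo_pos b _ (by simp)
      refine ⟨-q * N * c, mul_ne_zero (mul_ne_zero (neg_ne_zero.mpr hq)
        (Nat.cast_ne_zero.mpr hN0.ne')) hc, fun l hl => ?_⟩
      rw [pow_succ, Module.End.mul_apply, raising_apply_word hEF hHF hw hE, map_smul]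
      have h1 : ∀ L : List (List K[X]), (∀ l' ∈ L, l'.length = n + 1 ∧ l'.prod = b * l.prod) →
          ((E b) ^ n) (L.map fun l' => (l'.map F).prod w).sum =
            L.length • c • F (b ^ (n + 1) * l.prod) w := by
        intro L
        induction L with
        | nil => intro _; simp
        | cons l' L ihL =>
          intro hL
          rw [List.map_cons, List.sum_cons, map_add,
            ihL fun l'' hl'' => hL l'' (List.mem_cons_of_mem _ hl''),
            h l' (hL l' List.mem_cons_self).1, (hL l' List.mem_cons_self).2, List.length_cons,
            succ_nsmul', pow_succ, mul_assoc]
      rw [h1 _ fun l' hl' => ⟨by have := (mem_mergeTwo hl').1; omega, (mem_mergeTwo hl').2⟩,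
        length_mergeTwo_eq b (l' := List.replicate (n + 2) 1) (by simpa using hl),
        ← hN, ← Nat.cast_smul_eq_nsmul K, smul_smul, smul_smul]
  obtain ⟨c, hc, h⟩ := key n
  have h2 := h (List.replicate (n + 1) 1) (by simp)
  rw [List.map_replicate, List.prod_replicate, hF, map_zero, List.prod_replicate, one_pow,
    mul_one] at h2
  exact (smul_eq_zero.mp h2.symm).resolve_left hc

end Merge

end TwistedLoop
end

noncomputable section
namespace TwistedLoop

/-! ### Logarithms of the defining power series. -/

section Exponential

variable {A : Type*} [Ring A]

lemma coeff_pow_eq_zero_of_lt {S : PowerSeries A} (hS : PowerSeries.coeff 0 S = 0) :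
    ∀ n k : ℕ, k < n → PowerSeries.coeff k (S ^ n) = 0
  | 0, k, h => absurd h (Nat.not_lt_zero k)
  | n + 1, k, h => by
    rw [pow_succ', PowerSeries.coeff_mul]
    refine Finset.sum_eq_zero fun p hp => ?_
    rw [Finset.HasAntidiagonal.mem_antidiagonal] at hp
    rcases Nat.eq_zero_or_pos p.1 with h0 | h0
    · rw [h0, hS, zero_mul]
    · rw [coeff_pow_eq_zero_of_lt hS n p.2 (by omega), mul_zero]

variable [Algebra ℂ A]

lemma coeff_expSeries_eq {S : PowerSeries A} (hS : PowerSeries.coeff 0 S = 0) {k n : ℕ}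
    (hn : k < n) : PowerSeries.coeff k (expSeries S) =
      ∑ i ∈ Finset.range n, ((i.factorial : ℂ)⁻¹) • PowerSeries.coeff k (S ^ i) := by
  rw [expSeries, PowerSeries.coeff_mk]
  apply Finset.sum_subset (Finset.range_mono hn)
  intro i _ hi
  rw [coeff_pow_eq_zero_of_lt hS i k (by simpa using hi), smul_zero]

variable {W : Type*} [AddCommGroup W] [Module ℂ W] [Module A W] [IsScalarTower ℂ A W]
  {S : PowerSeries A} {s : PowerSeries ℂ} {w : W}

/-- Without constant terms, coefficient `k` of an `n`-th power with `n ≠ 1` involves only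
coefficients of degree below `k`. The coefficients of `S` need not commute: it suffices that `w` is
a common eigenvector of the lower ones. -/
lemma coeff_pow_smul_eq (hSs : ∀ k, k = 0 → PowerSeries.coeff k S = 0 ∧ PowerSeries.coeff k s = 0)
    {k : ℕ} (h : ∀ j < k, PowerSeries.coeff j S • w = PowerSeries.coeff j s • w) :
    ∀ n j : ℕ, (j < k ∨ j = k ∧ n ≠ 1) →
      PowerSeries.coeff j (S ^ n) • w = PowerSeries.coeff j (s ^ n) • w
  | 0, j, _ => by
    rw [pow_zero, pow_zero, PowerSeries.coeff_one, PowerSeries.coeff_one]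
    split_ifs <;> simp
  | n + 1, j, hj => by
    have := IsScalarTower.to_smulCommClass' (R := ℂ) (A := A) (M := W)
    rw [pow_succ', pow_succ', PowerSeries.coeff_mul, PowerSeries.coeff_mul, Finset.sum_smul,
      Finset.sum_smul]
    refine Finset.sum_congr rfl fun p hp => ?_
    rw [Finset.HasAntidiagonal.mem_antidiagonal] at hp
    rcases Nat.eq_zero_or_pos p.1 with h0 | h0
    · simp [(hSs _ h0).1, (hSs _ h0).2]
    rcases lt_or_ge p.1 k with h1 | h1
    · rw [mul_smul, mul_smul, coeff_pow_smul_eq hSs h n p.2 (by omega),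
        smul_comm (PowerSeries.coeff p.1 S), h p.1 h1, smul_comm]
    -- Here the first factor already has degree `k`, so the second has degree zero; as the exponent
    -- is not `1`, a positive power without constant term remains.
    · have hn : 0 < n := by omega
      have h2 : p.2 < n := by omega
      rw [coeff_pow_eq_zero_of_lt (hSs 0 rfl).1 n _ h2, coeff_pow_eq_zero_of_lt (hSs 0 rfl).2 n _ h2,
        mul_zero, mul_zero, zero_smul, zero_smul]

/-- If the coefficients of the exponential of `S` act on a vector as those of the exponential of a
scalar series `s`, then the coefficients of `S` act as those of `s`. -/
lemma coeff_smul_eq_of_expSeries (hS : PowerSeries.coeff 0 S = 0) (hs : PowerSeries.coeff 0 s = 0)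
    (h : ∀ k, PowerSeries.coeff k (expSeries S) • w = PowerSeries.coeff k (expSeries s) • w)
    (k : ℕ) : PowerSeries.coeff k S • w = PowerSeries.coeff k s • w := by
  induction k using Nat.strong_induction_on with
  | _ k ih =>
    rcases Nat.eq_zero_or_pos k with rfl | hk
    · rw [hS, hs, zero_smul, zero_smul]
    have h1 := h k
    rw [expSeries, expSeries, PowerSeries.coeff_mk, PowerSeries.coeff_mk,
      -- The linear term is coefficient `k` of the logarithm itself; all others agree by induction.
      ← Finset.add_sum_erase _ _ (show 1 ∈ Finset.range (k + 1) by simp; omega),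
      ← Finset.add_sum_erase _ _ (show 1 ∈ Finset.range (k + 1) by simp; omega),
      add_smul, add_smul, Finset.sum_smul, Finset.sum_smul] at h1
    have h2 : ∀ n ∈ (Finset.range (k + 1)).erase 1,
        (((n.factorial : ℂ)⁻¹) • PowerSeries.coeff k (S ^ n)) • w =
        (((n.factorial : ℂ)⁻¹) • PowerSeries.coeff k (s ^ n)) • w := by
      intro n hn
      rw [smul_assoc, smul_assoc, coeff_pow_smul_eq (fun k hk => by rw [hk]; exact ⟨hS, hs⟩) ih n k
        (Or.inr ⟨rfl, (Finset.mem_erase.mp hn).1⟩)]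
    rw [Finset.sum_congr rfl h2] at h1
    simpa using add_right_cancel h1

open PowerSeries in
-- The differential equation determines each coefficient from the earlier ones.
lemma eq_of_derivative_eq_mul {f g t : PowerSeries ℂ} (hf : derivative ℂ f = t * f)
    (hg : derivative ℂ g = t * g) (h0 : coeff 0 f = coeff 0 g) : f = g := by
  ext k
  induction k using Nat.strong_induction_on with
  | _ k ih =>
    cases k with
    | zero => exact h0
    | succ k =>
      have h1 := congrArg (coeff k) hf
      have h2 := congrArg (coeff k) hg
      rw [coeff_derivative, coeff_mul] at h1 h2
      have h3 : ∑ p ∈ Finset.HasAntidiagonal.antidiagonal k, coeff p.1 t * coeff p.2 f =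
          ∑ p ∈ Finset.HasAntidiagonal.antidiagonal k, coeff p.1 t * coeff p.2 g := by
        refine Finset.sum_congr rfl fun p hp => ?_
        rw [Finset.HasAntidiagonal.mem_antidiagonal] at hp
        rw [ih p.2 (by omega)]
      rw [h3, ← h2] at h1
      exact mul_right_cancel₀ (Nat.cast_add_one_ne_zero k) h1

open PowerSeries in
lemma derivative_expSeries {s : PowerSeries ℂ} (hs : coeff 0 s = 0) :
    derivative ℂ (expSeries s) = derivative ℂ s * expSeries s := by
  ext k
  have h1 : coeff k (derivative ℂ s * expSeries s) =
      coeff k (derivative ℂ s * ∑ i ∈ Finset.range (k + 1), ((i.factorial : ℂ)⁻¹) • s ^ i) := by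
    rw [coeff_mul, coeff_mul]
    refine Finset.sum_congr rfl fun p hp => ?_
    rw [Finset.HasAntidiagonal.mem_antidiagonal] at hp
    rw [coeff_expSeries_eq hs (show p.2 < k + 1 by omega), map_sum]
    simp
  rw [h1, coeff_derivative, coeff_expSeries_eq hs (Nat.lt_succ_self (k + 1)),
    Finset.sum_range_succ', Finset.mul_sum, map_sum, add_mul, Finset.sum_mul]
  have h2 : (((Nat.factorial 0 : ℕ) : ℂ)⁻¹ • coeff (k + 1) (s ^ 0)) * ((k : ℂ) + 1) = 0 := by
    simp [coeff_one]
  rw [h2, add_zero]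
  refine Finset.sum_congr rfl fun i _ => ?_
  have h3 : derivative ℂ (s ^ (i + 1)) = ((i : ℂ) + 1) • (derivative ℂ s * s ^ i) := by
    rw [Derivation.leibniz_pow, add_tsub_cancel_right, ← Nat.cast_smul_eq_nsmul ℂ, smul_eq_mul,
      mul_comm (s ^ i)]
    push_cast
    rfl
  have h4 := congrArg (coeff k) h3
  rw [coeff_derivative] at h4
  rw [smul_mul_assoc, h4, mul_smul_comm, Nat.factorial_succ]
  simp only [map_smul, smul_eq_mul]
  have : (i.factorial : ℂ) ≠ 0 := Nat.cast_ne_zero.mpr (Nat.factorial_ne_zero i)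
  have : (i : ℂ) + 1 ≠ 0 := Nat.cast_add_one_ne_zero i
  push_cast
  field_simp

/-- The logarithm of `∏ (1 - a u)`. -/
def logProd (R : Multiset ℂ) : PowerSeries ℂ :=
  PowerSeries.mk fun r => -((r : ℂ)⁻¹ * (R.map (· ^ r)).sum)

open PowerSeries in
lemma derivative_logProd (R : Multiset ℂ) :
    derivative ℂ (logProd R) = PowerSeries.mk fun r => -(R.map (· ^ (r + 1))).sum := by
  ext r
  rw [coeff_derivative, logProd, coeff_mk, coeff_mk]
  have : (r : ℂ) + 1 ≠ 0 := Nat.cast_add_one_ne_zero r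
  push_cast
  field_simp

/-- The polynomial `∏ (1 - a u)`. -/
def revProd (R : Multiset ℂ) : ℂ[X] :=
  (R.map fun a => 1 - Polynomial.C a * Polynomial.X).prod

open PowerSeries in
-- The logarithmic derivative of a product is additive, and that of `1 - a u` is minus a geometric
-- series.
lemma derivative_revProd (R : Multiset ℂ) :
    derivative ℂ (revProd R : PowerSeries ℂ) = derivative ℂ (logProd R) * (revProd R) := by
  induction R using Multiset.induction_on with
  | empty => simp [derivative_logProd, revProd]; rfl
  | cons a R ih =>
    have h1 : (revProd (a ::ₘ R) : PowerSeries ℂ) = (1 - C a * PowerSeries.X) * (revProd R : PowerSeries ℂ) := by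
      rw [revProd, Multiset.map_cons, Multiset.prod_cons, Polynomial.coe_mul, Polynomial.coe_sub,
        Polynomial.coe_mul, Polynomial.coe_C, Polynomial.coe_X, Polynomial.coe_one, revProd]
    have h2 : derivative ℂ (logProd (a ::ₘ R)) =
        -(PowerSeries.mk fun r => a ^ (r + 1)) + derivative ℂ (logProd R) := by
      ext r
      simp [derivative_logProd]
      ring
    have h3 : (1 - C a * PowerSeries.X : PowerSeries ℂ) * (PowerSeries.mk fun r => a ^ (r + 1)) =
        C a := by
      ext r
      rw [sub_mul, one_mul, mul_assoc, map_sub, coeff_C_mul, coeff_mk]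
      cases r with
      | zero => simp
      | succ r => rw [coeff_succ_X_mul, coeff_mk, coeff_C]; simp; ring
    have h4 : derivative ℂ (1 - C a * PowerSeries.X : PowerSeries ℂ) = - C a := by
      rw [map_sub, Derivation.leibniz]
      simp
    rw [h1, h2, Derivation.leibniz, ih, h4, smul_eq_mul, smul_eq_mul]
    linear_combination (revProd R : PowerSeries ℂ) * h3

lemma expSeries_logProd (R : Multiset ℂ) : expSeries (logProd R) = (revProd R : PowerSeries ℂ) := by
  -- The constant term vanishes because the inverse of `0` is `0`, although the zeroth power sum is
  -- the cardinality of `R`.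
  have h0 : PowerSeries.coeff 0 (logProd R) = 0 := by simp [logProd]
  refine eq_of_derivative_eq_mul (derivative_expSeries h0) (derivative_revProd R) ?_
  rw [coeff_expSeries_eq h0 (Nat.lt_succ_self 0)]
  simp [revProd, Polynomial.coeff_zero_multiset_prod]

end Exponential

end TwistedLoop
end

noncomputable section
namespace TwistedLoop

/-! ### Sequences satisfying linear recurrences. -/

section Shift

variable {V V' : Type*} [AddCommGroup V] [Module ℂ V] [AddCommGroup V'] [Module ℂ V']

/-- The operator `F ↦ F(· + M)` on sequences. -/
def shift (M : ℤ) : Module.End ℂ (ℤ → V) where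
  toFun F r := F (r + M)
  map_add' _ _ := rfl
  map_smul' _ _ := rfl

/-- The sequence `b(shift) F`. -/
def polyShift (M : ℤ) (b : ℂ[X]) (F : ℤ → V) : ℤ → V := Polynomial.aeval (shift M) b F

lemma shift_pow_apply (M : ℤ) (n : ℕ) (F : ℤ → V) (r : ℤ) :
    ((shift M) ^ n) F r = F (r + M * n) := by
  induction n generalizing r with
  | zero => simp
  | succ n ih =>
    rw [pow_succ', Module.End.mul_apply]
    change ((shift M) ^ n) F (r + M) = _
    rw [ih]
    congr 1
    push_cast
    ring

lemma polyShift_apply (M : ℤ) (b : ℂ[X]) (F : ℤ → V) (r : ℤ) :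
    polyShift M b F r = b.sum fun n c => c • F (r + M * n) := by
  rw [polyShift, Polynomial.aeval_eq_sum_range, Polynomial.sum_over_range _ (by simp),
    LinearMap.sum_apply, Finset.sum_apply]
  refine Finset.sum_congr rfl fun n _ => ?_
  rw [LinearMap.smul_apply, Pi.smul_apply, shift_pow_apply]

lemma polyShift_mul (M : ℤ) (b c : ℂ[X]) (F : ℤ → V) :
    polyShift M (b * c) F = polyShift M b (polyShift M c F) := by
  rw [polyShift, map_mul, Module.End.mul_apply]
  rfl

lemma polyShift_zero (M : ℤ) (b : ℂ[X]) : polyShift M b (0 : ℤ → V) = 0 := map_zero _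

lemma polyShift_add (M : ℤ) (b : ℂ[X]) (F G : ℤ → V) :
    polyShift M b (F + G) = polyShift M b F + polyShift M b G := map_add _ _ _

lemma polyShift_map (M : ℤ) (b : ℂ[X]) (φ : V →ₗ[ℂ] V') (F : ℤ → V) (r : ℤ) :
    φ (polyShift M b F r) = polyShift M b (fun k => φ (F k)) r := by
  rw [polyShift_apply, polyShift_apply, Polynomial.sum, Polynomial.sum, map_sum]
  exact Finset.sum_congr rfl fun n _ => map_smul _ _ _

lemma polyShift_mul_periodic {M : ℤ} {θ : ℤ → ℂ} (hθ : ∀ r, θ (r + M) = θ r) (b : ℂ[X])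
    (F : ℤ → V) : polyShift M b (fun r => θ r • F r) = fun r => θ r • polyShift M b F r := by
  have h : ∀ r, ∀ n : ℕ, θ (r + M * n) = θ r := by
    intro r n
    induction n with
    | zero => simp
    | succ n ih => rw [← ih, ← hθ (r + M * n)]; congr 1; push_cast; ring
  ext r
  rw [polyShift_apply, polyShift_apply, Polynomial.sum, Polynomial.sum, Finset.smul_sum]
  refine Finset.sum_congr rfl fun n _ => ?_
  rw [h, smul_comm]

/-- The sequences that satisfy a linear recurrence with constant coefficients. -/
def recurrent (M : ℤ) : Submodule ℂ (ℤ → V) where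
  carrier := {F | ∃ b : ℂ[X], b ≠ 0 ∧ polyShift M b F = 0}
  zero_mem' := ⟨1, one_ne_zero, polyShift_zero _ _⟩
  add_mem' := by
    rintro F G ⟨b, hb, hF⟩ ⟨c, hc, hG⟩
    refine ⟨b * c, mul_ne_zero hb hc, ?_⟩
    rw [polyShift_add, mul_comm, polyShift_mul, hF, mul_comm, polyShift_mul, hG, polyShift_zero,
      polyShift_zero, add_zero]
  smul_mem' := by
    rintro a F ⟨b, hb, hF⟩
    refine ⟨b, hb, ?_⟩
    rw [polyShift] at hF ⊢
    rw [map_smul, hF, smul_zero]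

lemma exponential_mem_recurrent (M : ℤ) {a : ℂ} (ha : a ≠ 0) (v : V) :
    (fun r : ℤ => a ^ r • v) ∈ recurrent (V := V) M := by
  refine ⟨Polynomial.X - Polynomial.C (a ^ M), Polynomial.X_sub_C_ne_zero _, ?_⟩
  ext r
  rw [polyShift, map_sub, Polynomial.aeval_X, Polynomial.aeval_C, LinearMap.sub_apply,
    Module.algebraMap_end_apply]
  change a ^ (r + M) • v - a ^ M • a ^ r • v = 0
  rw [zpow_add₀ ha, smul_smul, mul_comm, sub_self]

/-- A factor of period `M` commutes with the shift by `M`. This is why recurrences have step `M`: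
congruence and parity conditions on the degree then do no harm. -/
lemma mul_mem_recurrent {M : ℤ} {θ : ℤ → ℂ} (hθ : ∀ r, θ (r + M) = θ r) {F : ℤ → V}
    (hF : F ∈ recurrent (V := V) M) : (fun r => θ r • F r) ∈ recurrent (V := V) M := by
  obtain ⟨b, hb, h⟩ := hF
  refine ⟨b, hb, ?_⟩
  rw [polyShift_mul_periodic hθ, h]
  ext r
  exact smul_zero _

lemma powerSum_mem_recurrent (M : ℤ) {R : Multiset ℂ} (hR : ∀ a ∈ R, a ≠ 0) (v : V) :
    (fun r : ℤ => (R.map (· ^ r)).sum • v) ∈ recurrent (V := V) M := by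
  induction R using Multiset.induction_on with
  | empty =>
    simp only [Multiset.map_zero, Multiset.sum_zero, zero_smul]
    exact zero_mem (recurrent (V := V) M)
  | cons a R ih =>
    have h := add_mem (exponential_mem_recurrent M (hR a (Multiset.mem_cons_self a R)) v)
      (ih fun b hb => hR b (Multiset.mem_cons_of_mem hb))
    convert! h using 1
    ext r
    simp [add_smul]

/-- A linear family of recurrent sequences with finitely many parameters satisfies a common
recurrence. -/
lemma exists_common_recurrence [Module.Finite ℂ V'] {M : ℤ} (Φ : V' →ₗ[ℂ] (ℤ → V))
    (h : ∀ x, Φ x ∈ recurrent (V := V) M) :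
    ∃ b : ℂ[X], b ≠ 0 ∧ ∀ x, polyShift M b (Φ x) = 0 := by
  choose b hb hΦ using h
  obtain ⟨s, hs⟩ := (Module.Finite.fg_top : (⊤ : Submodule ℂ V').FG)
  refine ⟨∏ x ∈ s, b x, Finset.prod_ne_zero_iff.mpr fun x _ => hb x, fun x => ?_⟩
  have hx : x ∈ Submodule.span ℂ (s : Set V') := hs ▸ Submodule.mem_top
  induction hx using Submodule.span_induction with
  | zero => rw [map_zero, polyShift_zero]
  | add x y _ _ hx hy => rw [map_add, polyShift_add, hx, hy, add_zero]
  | smul a x _ hx => rw [map_smul, polyShift, map_smul, ← polyShift, hx, smul_zero]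
  | mem x hx =>
    classical
    rw [← Finset.mul_prod_erase s b hx, mul_comm, polyShift_mul, hΦ, polyShift_zero]

/-- Removing one root `a`, the sequence `G = (shift - a) F` satisfies a shorter recurrence. Modulo
the values of `G`, the sequence `F` is geometric of step `M`, so the `M` values on a period span the
rest. -/
lemma finite_span_range_of_polyShift_prod {M : ℤ} (hM : 0 < M) (R : Multiset ℂ) :
    ∀ F : ℤ → V, polyShift M ((R.map fun a => Polynomial.X - Polynomial.C a).prod) F = 0 →
      FiniteDimensional ℂ (Submodule.span ℂ (Set.range F)) := by
  induction R using Multiset.induction_on with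
  | empty =>
    intro F hF
    have hF : F = 0 := by simpa [polyShift] using hF
    subst hF
    exact FiniteDimensional.span_of_finite ℂ (Set.finite_range_const (c := (0 : V)))
  | cons a R ih =>
    intro F hF
    rw [Multiset.map_cons, Multiset.prod_cons, mul_comm, polyShift_mul] at hF
    set G := polyShift M (Polynomial.X - Polynomial.C a) F with hG
    have hfin := ih G hF
    set N := Submodule.span ℂ (Set.range G)
    have hrec : ∀ r, F (r + M) = G r + a • F r := by
      intro r
      rw [hG, polyShift, map_sub, Polynomial.aeval_X, Polynomial.aeval_C, LinearMap.sub_apply,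
        Module.algebraMap_end_apply, Pi.sub_apply, Pi.smul_apply, sub_add_cancel]
      rfl
    have hGN : ∀ r, G r ∈ N := fun r => Submodule.subset_span ⟨r, rfl⟩
    set N' := Submodule.span ℂ (F '' Set.Ico 0 M)
    have hfin' : FiniteDimensional ℂ N' :=
      FiniteDimensional.span_of_finite ℂ ((Set.finite_Ico 0 M).image F)
    have hle : Submodule.span ℂ (Set.range F) ≤ N ⊔ N' := by
      refine Submodule.span_le.mpr ?_
      rintro _ ⟨r, rfl⟩
      -- For `a = 0` the recurrence cannot be run backwards, but then every value of `F` is a value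
      -- of `G`.
      rcases eq_or_ne a 0 with ha | ha
      · have := hrec (r - M)
        rw [sub_add_cancel, ha, zero_smul, add_zero] at this
        rw [this]
        exact Submodule.mem_sup_left (hGN _)
      have h1 : ∀ q : ℤ, F (r % M + M * q) ∈ N ⊔ N' := by
        intro q
        induction q using Int.induction_on with
        | zero =>
          refine Submodule.mem_sup_right (Submodule.subset_span ⟨_, ?_, rfl⟩)
          rw [mul_zero, add_zero]
          exact ⟨Int.emod_nonneg r hM.ne', Int.emod_lt_of_pos r hM⟩
        | succ q hq =>
          have := hrec (r % M + M * q)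
          rw [mul_add, mul_one, ← add_assoc, this]
          exact add_mem (Submodule.mem_sup_left (hGN _)) (Submodule.smul_mem _ _ hq)
        | pred q hq =>
          have := hrec (r % M + M * (-q - 1))
          rw [show r % M + M * (-(q : ℤ) - 1) + M = r % M + M * (-q) by ring] at this
          have h2 : a • F (r % M + M * (-q - 1)) ∈ N ⊔ N' := by
            rw [← sub_eq_iff_eq_add'.mpr this]
            exact sub_mem hq (Submodule.mem_sup_left (hGN _))
          have h3 := Submodule.smul_mem _ a⁻¹ h2
          rwa [smul_smul, inv_mul_cancel₀ ha, one_smul] at h3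
      have h2 := h1 (r / M)
      rwa [Int.emod_add_mul_ediv] at h2
    exact Submodule.finiteDimensional_of_le hle

/-- The values of a recurrent sequence span a space of finite dimension. -/
lemma finite_span_range_of_polyShift {M : ℤ} (hM : 0 < M) {b : ℂ[X]} (hb : b ≠ 0) {F : ℤ → V}
    (h : polyShift M b F = 0) : FiniteDimensional ℂ (Submodule.span ℂ (Set.range F)) := by
  apply finite_span_range_of_polyShift_prod hM b.roots
  rw [(IsAlgClosed.splits b).eq_prod_roots, polyShift_mul, polyShift, Polynomial.aeval_C,
    Module.algebraMap_end_apply] at h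
  exact (smul_eq_zero.mp h).resolve_left (Polynomial.leadingCoeff_ne_zero.mpr hb)

end Shift

end TwistedLoop
end

noncomputable section
namespace TwistedLoop

/-! ### Nilpotency criteria from eigenvalues, traces and cyclicity. -/

section General

open LieModule LieAlgebra

variable {K V A : Type*} [Field K] [CharZero K] [AddCommGroup V] [Module K V]

/-- An endomorphism that is an eigenvector of `⁅h, ·⁆` for a nonzero eigenvalue is nilpotent. -/
lemma isNilpotent_of_mul_sub_mul [FiniteDimensional K V] {h x : Module.End K V} {c : K}
    (hc : c ≠ 0) (hx : h * x - x * h = c • x) : IsNilpotent x := by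
  by_contra hcon
  have h1 : ∀ n : ℕ, h * x ^ n - x ^ n * h = ((n : K) * c) • x ^ n := by
    intro n
    induction n with
    | zero => simp
    | succ n ih =>
      have : h * x ^ (n + 1) - x ^ (n + 1) * h =
          (h * x ^ n - x ^ n * h) * x + x ^ n * (h * x - x * h) := by
        rw [pow_succ]
        noncomm_ring
      rw [this, ih, hx, smul_mul_assoc, mul_smul_comm, ← pow_succ, ← add_smul]
      congr 1
      push_cast
      ring
  -- If no power of `x` vanished, they would be eigenvectors for the distinct eigenvalues `n c`,
  -- hence infinitely many independent vectors.
  set D : Module.End K (Module.End K V) := LinearMap.mulLeft K h - LinearMap.mulRight K h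
  have h2 : ∀ n : ℕ, D.HasEigenvector ((n : K) * c) (x ^ n) := by
    intro n
    rw [Module.End.hasEigenvector_iff, Module.End.mem_eigenspace_iff]
    exact ⟨by simpa [D] using h1 n, fun h0 => hcon ⟨n, h0⟩⟩
  have h3 := Module.End.eigenvectors_linearIndependent' D (fun n : ℕ => (n : K) * c)
    (fun m n hmn => by simpa [hc] using hmn) (fun n => x ^ n) h2
  have h4 : Finite ℕ := LinearIndependent.finite_of_isNoetherian h3
  exact not_finite ℕ

/-- If `h = e f - f e` commutes with `e` and `f`, its only possible eigenvalue is `0`. -/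
lemma eigenvalue_eq_zero_of_commutator [FiniteDimensional K V] {e f h : Module.End K V}
    (hef : e * f - f * e = h) (he : Commute h e) (hf : Commute h f) {μ : K} {v : V} (hv : v ≠ 0)
    (hμ : h v = μ • v) : μ = 0 := by
  set N := h.eigenspace μ
  have hN : ∀ g : Module.End K V, Commute h g → ∀ u ∈ N, g u ∈ N := by
    intro g hg u hu
    rw [Module.End.mem_eigenspace_iff] at hu ⊢
    rw [← Module.End.mul_apply, hg.eq, Module.End.mul_apply, hu, map_smul]
  set e' := e.restrict (hN e he)
  set f' := f.restrict (hN f hf)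
  have h1 : e' * f' - f' * e' = μ • 1 := by
    ext u
    have := Module.End.mem_eigenspace_iff.mp u.2
    rw [← hef] at this
    simpa [e', f'] using this
  -- On the eigenspace the scalar `μ` is a commutator, so `μ` times the dimension is zero.
  have h2 := congrArg (LinearMap.trace K N) h1
  rw [map_sub, LinearMap.trace_mul_comm, sub_self, map_smul, LinearMap.trace_one, smul_eq_mul] at h2
  refine (mul_eq_zero.mp h2.symm).resolve_right ?_
  have : Nontrivial N := ⟨⟨⟨v, Module.End.mem_eigenspace_iff.mpr hμ⟩, 0, fun h0 =>
    hv (congrArg Subtype.val h0)⟩⟩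
  exact Nat.cast_ne_zero.mpr Module.finrank_pos.ne'

variable [LieRing A] [LieAlgebra K A] [LieRingModule A V] [LieModule K A V]

lemma isLocallyNilpotent_ad [FiniteDimensional K A] {h x : A} {c : K} (hc : c ≠ 0)
    (hx : ⁅h, x⁆ = c • x) : IsLocallyNilpotent (ad K A x) := by
  obtain ⟨n, hn⟩ := isNilpotent_of_mul_sub_mul (h := ad K A h) (x := ad K A x) hc (by
    ext v
    have h1 := lie_lie h x v
    rw [hx, smul_lie] at h1
    exact h1.symm)
  exact fun v => ⟨n, by rw [hn]; rfl⟩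

omit [CharZero K] in
-- By the Leibniz rule the vectors killed by some power of `x` form a submodule, and it contains the
-- generator.
lemma isLocallyNilpotent_toEnd {x : A} (hx : IsLocallyNilpotent (ad K A x)) {w : V} {k : ℕ}
    (hk : ((toEnd K A V x) ^ k) w = 0)
    (hw : ∀ N : Submodule K V, w ∈ N → (∀ x : A, ∀ v ∈ N, ⁅x, v⁆ ∈ N) → N = ⊤) :
    IsLocallyNilpotent (toEnd K A V x) := by
  let N : Submodule K V :=
    { carrier := {v | ∃ n : ℕ, ((toEnd K A V x) ^ n) v = 0}
      zero_mem' := ⟨0, map_zero _⟩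
      add_mem' := by
        rintro u v ⟨a, ha⟩ ⟨b, hb⟩
        refine ⟨max a b, ?_⟩
        rw [map_add, pow_apply_eq_zero_of_le (le_max_left a b) ha,
          pow_apply_eq_zero_of_le (le_max_right a b) hb, add_zero]
      smul_mem' := by
        rintro c v ⟨a, ha⟩
        exact ⟨a, by rw [map_smul, ha, smul_zero]⟩ }
  have hN : N = ⊤ := by
    refine hw N ⟨k, hk⟩ ?_
    rintro y v ⟨b, hb⟩
    obtain ⟨a, ha⟩ := hx y
    refine ⟨a + b, ?_⟩
    rw [toEnd_pow_lie]
    refine Finset.sum_eq_zero fun p hp => ?_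
    rw [Finset.HasAntidiagonal.mem_antidiagonal] at hp
    rcases lt_or_ge p.1 a with h | h
    · rw [pow_apply_eq_zero_of_le (by omega) hb, lie_zero, smul_zero]
    · rw [pow_apply_eq_zero_of_le h ha, zero_lie, smul_zero]
  exact fun v => (hN ▸ Submodule.mem_top : v ∈ N)

end General

/-! ### Averaging over the automorphism, and the elements of the twisted loop algebra. -/

namespace DiagramAutomorphism

variable {ι L : Type*} [Fintype ι] [LieRing L] [LieAlgebra ℂ L]
  {H : LieSubalgebra ℂ L} {B : LieAlgebra.Basis ι H} (D : DiagramAutomorphism B)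

/-- The automorphism `σ` as a linear map. -/
def sigma : Module.End ℂ L := D.σ.toLinearEquiv

lemma sigma_apply (x : L) : D.sigma x = D.σ x := rfl

lemma m_pos : 0 < D.m := orderOf_pos D.perm

lemma sigma_pow_lie (j : ℕ) (x y : L) :
    (D.sigma ^ j) ⁅x, y⁆ = ⁅(D.sigma ^ j) x, (D.sigma ^ j) y⁆ := by
  induction j with
  | zero => rfl
  | succ j ih =>
    simp only [pow_succ', Module.End.mul_apply, ih, sigma_apply, LieEquiv.map_lie]

lemma sigma_pow_of_map {y : ι → L} (hy : ∀ i, D.σ (y i) = y (D.perm i)) (j : ℕ) (i : ι) :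
    (D.sigma ^ j) (y i) = y ((D.perm ^ j) i) := by
  induction j with
  | zero => rfl
  | succ j ih =>
    rw [pow_succ', Module.End.mul_apply, ih, sigma_apply, hy, pow_succ', Equiv.Perm.mul_apply]

/-- A Lie subalgebra that contains the Chevalley generators `e i`, `f i` is everything. -/
lemma mem_of_generators (S : LieSubalgebra ℂ L) (he : ∀ i, B.e i ∈ S) (hf : ∀ i, B.f i ∈ S)
    (x : L) : x ∈ S := by
  have h : LieSubalgebra.lieSpan ℂ L (Set.range B.e ∪ Set.range B.f) ≤ S := by
    rw [LieSubalgebra.lieSpan_le]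
    rintro _ (⟨i, rfl⟩ | ⟨i, rfl⟩)
    · exact he i
    · exact hf i
  rw [B.span_ef] at h
  exact h (LieSubalgebra.mem_top x)

/-- The number `m` is the order of the permutation only; equality of automorphisms spreads from the
Chevalley generators to the algebra they generate. -/
lemma sigma_pow_m : D.sigma ^ D.m = 1 := by
  let S : LieSubalgebra ℂ L :=
    { LinearMap.eqLocus (D.sigma ^ D.m) (1 : Module.End ℂ L) with
      lie_mem' := by
        intro x y hx hy
        change (D.sigma ^ D.m) ⁅x, y⁆ = ⁅x, y⁆
        rw [D.sigma_pow_lie]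
        exact congrArg₂ _ hx hy }
  ext x
  refine mem_of_generators (B := B) S (fun i => ?_) (fun i => ?_) x
  · change (D.sigma ^ D.m) (B.e i) = B.e i
    rw [D.sigma_pow_of_map D.map_e, D.perm_pow_m]
  · change (D.sigma ^ D.m) (B.f i) = B.f i
    rw [D.sigma_pow_of_map D.map_f, D.perm_pow_m]

/-- The projection to `𝔤_ε`, `ε ≡ -r`, multiplied by `m`. -/
def proj (r : ℤ) : Module.End ℂ L :=
  ∑ j ∈ Finset.range D.m, ((D.ζ ^ (j * r) : ℂˣ) : ℂ) • D.sigma ^ j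

lemma proj_apply (r : ℤ) (x : L) : D.proj r x =
    ∑ j ∈ Finset.range D.m, ((D.ζ ^ (j * r) : ℂˣ) : ℂ) • (D.sigma ^ j) x := by
  simp [proj, LinearMap.sum_apply]

lemma proj_of_map {y : ι → L} (hy : ∀ i, D.σ (y i) = y (D.perm i)) (r : ℤ) (i : ι) :
    D.proj r (y i) =
      ∑ j ∈ Finset.range D.m, ((D.ζ ^ (j * r) : ℂˣ) : ℂ) • y ((D.perm ^ j) i) := by
  rw [proj_apply]
  exact Finset.sum_congr rfl fun j _ => by rw [D.sigma_pow_of_map hy]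

lemma proj_add_of_dvd {k : ℤ} (hk : (D.m : ℤ) ∣ k) (r : ℤ) : D.proj (r + k) = D.proj r := by
  unfold proj
  refine Finset.sum_congr rfl fun j _ => ?_
  rw [mul_add, zpow_add, D.zeta_zpow_of_dvd (dvd_mul_of_dvd_right hk _), mul_one]

lemma proj_sigma (r : ℤ) (x : L) : D.proj r (D.σ x) = ((D.ζ ^ (-r) : ℂˣ) : ℂ) • D.proj r x := by
  set g : ℕ → L := fun j => ((D.ζ ^ (j * r) : ℂˣ) : ℂ) • (D.sigma ^ j) x with hg
  have hstep (j : ℕ) : ((D.ζ ^ (j * r) : ℂˣ) : ℂ) • (D.sigma ^ j) (D.σ x) =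
      ((D.ζ ^ (-r) : ℂˣ) : ℂ) • g (j + 1) := by
    simp only [hg]
    rw [smul_smul, ← Units.val_mul, ← zpow_add, pow_succ, Module.End.mul_apply, sigma_apply]
    congr 3
    push_cast; ring
  have hend : g D.m = g 0 := by
    simp only [hg]
    rw [D.zeta_zpow_of_dvd (ε := (D.m : ℤ) * r) (dvd_mul_right _ _), D.sigma_pow_m]
    simp
  rw [proj_apply, proj_apply, Finset.sum_congr rfl fun j _ => hstep j, ← Finset.smul_sum]
  congr 1
  have h3 := Finset.sum_range_succ g D.m
  rw [Finset.sum_range_succ', hend] at h3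
  exact add_right_cancel h3

lemma sigma_proj (r : ℤ) (x : L) : D.σ (D.proj r x) = ((D.ζ ^ (-r) : ℂˣ) : ℂ) • D.proj r x := by
  rw [← proj_sigma, ← sigma_apply, ← sigma_apply, ← Module.End.mul_apply, ← Module.End.mul_apply]
  congr 1
  rw [proj, Finset.mul_sum, Finset.sum_mul]
  refine Finset.sum_congr rfl fun j _ => ?_
  rw [mul_smul_comm, smul_mul_assoc, ← pow_succ, ← pow_succ']

lemma sigma_pow_proj (j : ℕ) (r : ℤ) (x : L) :
    (D.sigma ^ j) (D.proj r x) = ((D.ζ ^ (-(j * r)) : ℂˣ) : ℂ) • D.proj r x := by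
  induction j with
  | zero => simp
  | succ j ih =>
    rw [pow_succ', Module.End.mul_apply, ih, map_smul, sigma_apply, sigma_proj, smul_smul,
      ← Units.val_mul, ← zpow_add]
    congr 3
    push_cast; ring

/-- Each power of `σ` only rescales `proj s y`, so it can be moved inside the average. Hence
brackets can be computed with one factor not averaged, for instance a single `e_k`. -/
lemma lie_proj_proj (r s : ℤ) (x y : L) :
    ⁅D.proj r x, D.proj s y⁆ = D.proj (r + s) ⁅x, D.proj s y⁆ := by
  rw [D.proj_apply r x, D.proj_apply (r + s), sum_lie]
  refine Finset.sum_congr rfl fun j _ => ?_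
  rw [sigma_pow_lie, sigma_pow_proj, lie_smul, smul_lie, smul_smul, ← Units.val_mul, ← zpow_add]
  congr 3
  ring

/-- Orthogonality of the powers of `ζ`. It recovers an arbitrary second factor from the homogeneous
ones that occur in brackets of loops. -/
lemma sum_proj (x : L) : ∑ s ∈ Finset.range D.m, D.proj s x = (D.m : ℂ) • x := by
  simp_rw [proj_apply]
  rw [Finset.sum_comm]
  simp_rw [← Finset.sum_smul]
  rw [Finset.sum_eq_single_of_mem 0 (Finset.mem_range.mpr D.m_pos)]
  · simp
  intro j hj hj0
  have h1 : (D.ζ : ℂ) ^ j ≠ 1 := by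
    intro h
    have : D.ζ ^ j = 1 := Units.ext (by simpa using h)
    exact D.isPrimitiveRoot.pow_ne_one_of_pos_of_lt hj0 (Finset.mem_range.mp hj) this
  have h2 : ((D.ζ : ℂ) ^ j) ^ D.m = 1 := by
    rw [← pow_mul, mul_comm, pow_mul]
    have : D.ζ ^ D.m = 1 := D.isPrimitiveRoot.pow_eq_one
    rw [← Units.val_pow_eq_pow_val, this]
    simp
  have h3 := mul_geom_sum ((D.ζ : ℂ) ^ j) D.m
  rw [h2, sub_self] at h3
  have h4 := (mul_eq_zero.mp h3).resolve_left (sub_ne_zero.mpr h1)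
  have h5 : ∑ s ∈ Finset.range D.m, ((D.ζ ^ ((j : ℤ) * (s : ℤ)) : ℂˣ) : ℂ) = 0 := by
    rw [← h4]
    refine Finset.sum_congr rfl fun s _ => ?_
    rw [← pow_mul]
    norm_cast
  rw [h5, zero_smul]

lemma tens_add (x y : L) (r : ℤ) : tens (x + y) r = tens x r + tens y r :=
  TensorProduct.tmul_add _ _ _

lemma tens_smul (c : ℂ) (x : L) (r : ℤ) : tens (c • x) r = c • tens x r :=
  TensorProduct.tmul_smul _ _ _

lemma lie_tens (x y : L) (r s : ℤ) : ⁅tens x r, tens y s⁆ = tens ⁅x, y⁆ (r + s) := by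
  rw [tens, tens, LieAlgebra.ExtendScalars.bracket_tmul, AddMonoidAlgebra.single_mul_single,
    one_mul, tens]

/-- The sum of the images of `x ⊗ t^r` under the powers of the automorphism of the loop algebra. -/
def loop (r : ℤ) : L →ₗ[ℂ] D.twistedLoop where
  toFun x := D.twTens (D.proj r x) r (D.sigma_proj r x)
  map_add' x y := Subtype.ext (by
    change tens (D.proj r (x + y)) r = tens (D.proj r x) r + tens (D.proj r y) r
    rw [map_add, tens_add])
  map_smul' c x := Subtype.ext (by
    change tens (D.proj r (c • x)) r = c • tens (D.proj r x) r
    rw [map_smul, tens_smul])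

lemma coe_loop (r : ℤ) (x : L) :
    (D.loop r x : LieAlgebra.loopAlgebra ℂ ℤ L) = tens (D.proj r x) r := rfl

lemma lie_loop_loop (r s : ℤ) (x y : L) :
    ⁅D.loop r x, D.loop s y⁆ = D.loop (r + s) ⁅x, D.proj s y⁆ := by
  apply Subtype.ext
  rw [LieSubalgebra.coe_bracket, coe_loop, coe_loop, coe_loop, lie_tens, lie_proj_proj]

lemma loop_sigma (r : ℤ) (x : L) : D.loop r (D.σ x) = ((D.ζ ^ (-r) : ℂˣ) : ℂ) • D.loop r x := by
  apply Subtype.ext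
  change tens (D.proj r (D.σ x)) r = _ • tens (D.proj r x) r
  rw [proj_sigma, tens_smul]

/-- The twisted loop algebra is spanned by the elements `loop r x`. -/
lemma span_loop : Submodule.span ℂ {z | ∃ r x, z = D.loop r x} = ⊤ := by
  set N := Submodule.span ℂ {z | ∃ r x, z = D.loop r x}
  set T : LieAlgebra.loopAlgebra ℂ ℤ L →ₗ[ℂ] LieAlgebra.loopAlgebra ℂ ℤ L :=
    D.loopAut.toLinearMap
  have hT : ∀ r x, ∀ j : ℕ,
      (T ^ j) (tens x r) = ((D.ζ ^ (j * r) : ℂˣ) : ℂ) • tens ((D.sigma ^ j) x) r := by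
    intro r x j
    induction j with
    | zero => simp
    | succ j ih =>
      rw [pow_succ', Module.End.mul_apply, ih, map_smul]
      change _ • D.loopAut _ = _
      rw [loopAut_tens, smul_smul, ← Units.val_mul, ← zpow_add, pow_succ', Module.End.mul_apply,
        sigma_apply]
      congr 3
      push_cast; ring
  -- The average of any element lies in the span; a fixed element is its own average up to the
  -- factor `m`.
  have h1 : ∀ z : LieAlgebra.loopAlgebra ℂ ℤ L, ∃ t ∈ N,
      (t : LieAlgebra.loopAlgebra ℂ ℤ L) = ∑ j ∈ Finset.range D.m, (T ^ j) z := by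
    intro z
    induction z using TensorProduct.induction_on with
    | zero => exact ⟨0, zero_mem _, by simp⟩
    | add z z' hz hz' =>
      obtain ⟨t, ht, h⟩ := hz
      obtain ⟨t', ht', h'⟩ := hz'
      exact ⟨t + t', add_mem ht ht', by simp [h, h', Finset.sum_add_distrib]⟩
    | tmul g x =>
      induction g using AddMonoidAlgebra.induction_linear with
      | zero => exact ⟨0, zero_mem _, by simp⟩
      | add g g' hz hz' =>
        obtain ⟨t, ht, h⟩ := hz
        obtain ⟨t', ht', h'⟩ := hz'
        exact ⟨t + t', add_mem ht ht', by simp [h, h', Finset.sum_add_distrib, TensorProduct.add_tmul]⟩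
      | single r c =>
        have h2 : (AddMonoidAlgebra.single r c : AddMonoidAlgebra ℂ ℤ) ⊗ₜ[ℂ] x = tens (c • x) r := by
          rw [tens, TensorProduct.tmul_smul, TensorProduct.smul_tmul',
            AddMonoidAlgebra.smul_single, smul_eq_mul, mul_one]
        refine ⟨D.loop r (c • x), Submodule.subset_span ⟨r, _, rfl⟩, ?_⟩
        rw [h2, coe_loop, proj_apply, tens, TensorProduct.tmul_sum]
        refine Finset.sum_congr rfl fun j _ => ?_
        rw [hT]
        exact tens_smul _ _ _
  rw [eq_top_iff]
  intro z _
  obtain ⟨t, ht, h⟩ := h1 (z : LieAlgebra.loopAlgebra ℂ ℤ L)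
  have h2 : ∀ j, (T ^ j) (z : LieAlgebra.loopAlgebra ℂ ℤ L) = z := by
    intro j
    induction j with
    | zero => simp
    | succ j ih => rw [pow_succ', Module.End.mul_apply, ih]; exact z.2
  simp only [h2, Finset.sum_const, Finset.card_range] at h
  have h3 : z = (D.m : ℂ)⁻¹ • t := by
    apply Subtype.ext
    change (z : LieAlgebra.loopAlgebra ℂ ℤ L) = (D.m : ℂ)⁻¹ • (t : LieAlgebra.loopAlgebra ℂ ℤ L)
    rw [h, ← Nat.cast_smul_eq_nsmul ℂ, smul_smul,
      inv_mul_cancel₀ (Nat.cast_ne_zero.mpr D.m_pos.ne'), one_smul]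
  rw [h3]
  exact Submodule.smul_mem _ _ ht

/-- The period of all functions of the degree that occur. -/
def period : ℤ := 2 * D.m

lemma period_pos : 0 < D.period := by
  have := D.m_pos
  unfold period
  omega

lemma dvd_period : (D.m : ℤ) ∣ D.period := dvd_mul_left _ _

/-- The element `loop r x` multiplied by the polynomial `b` in `t^{2m}`. -/
def polyLoop (b : ℂ[X]) (r : ℤ) : L →ₗ[ℂ] D.twistedLoop :=
  b.sum fun n c => c • D.loop (r + D.period * n)

lemma polyLoop_apply (b : ℂ[X]) (r : ℤ) (x : L) :
    D.polyLoop b r x = b.sum fun n c => c • D.loop (r + D.period * n) x := by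
  simp [polyLoop, Polynomial.sum, LinearMap.sum_apply]

lemma polyLoop_eq_polyShift (b : ℂ[X]) (r : ℤ) (x : L) :
    D.polyLoop b r x = polyShift D.period b (fun k => D.loop k x) r := by
  rw [polyLoop_apply, polyShift_apply]

lemma polyLoop_one (r : ℤ) (x : L) : D.polyLoop 1 r x = D.loop r x := by
  rw [polyLoop_eq_polyShift, polyShift, map_one]
  rfl

lemma lie_polyLoop_loop (b : ℂ[X]) (r s : ℤ) (x y : L) :
    ⁅D.polyLoop b r x, D.loop s y⁆ = D.polyLoop b (r + s) ⁅x, D.proj s y⁆ := by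
  rw [polyLoop_apply, polyLoop_apply, Polynomial.sum, Polynomial.sum, sum_lie]
  refine Finset.sum_congr rfl fun n _ => ?_
  rw [smul_lie, lie_loop_loop]
  congr 2
  ring_nf

/-- Polynomials in `t^{2m}` multiply through the bracket, since a shift by a multiple of `m` leaves
the projection unchanged. -/
lemma lie_polyLoop_polyLoop (b c : ℂ[X]) (r s : ℤ) (x y : L) :
    ⁅D.polyLoop b r x, D.polyLoop c s y⁆ = D.polyLoop (b * c) (r + s) ⁅x, D.proj s y⁆ := by
  have h : D.polyLoop (b * c) (r + s) ⁅x, D.proj s y⁆ =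
      c.sum fun n a => a • D.polyLoop b (r + s + D.period * n) ⁅x, D.proj s y⁆ := by
    rw [polyLoop_eq_polyShift, mul_comm b c, polyShift_mul, polyShift_apply]
    simp_rw [← polyLoop_eq_polyShift]
  rw [h, D.polyLoop_apply c, Polynomial.sum, Polynomial.sum, lie_sum]
  refine Finset.sum_congr rfl fun n _ => ?_
  rw [lie_smul, lie_polyLoop_loop,
    D.proj_add_of_dvd (dvd_mul_of_dvd_left D.dvd_period _)]
  congr 2
  ring_nf

end DiagramAutomorphism
end TwistedLoop
end

/-! ### Orbits of nodes and the Cartan matrix. -/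

noncomputable section
namespace TwistedLoop
namespace DiagramAutomorphism

variable {ι L : Type*} [Fintype ι] [LieRing L] [LieAlgebra ℂ L]
  {H : LieSubalgebra ℂ L} {B : LieAlgebra.Basis ι H} (D : DiagramAutomorphism B)

lemma exists_rep (k : ι) : ∃ i ∈ D.I₀, ∃ j < D.m, (D.perm ^ j) i = k := by
  obtain ⟨i, ⟨hi, hc⟩, -⟩ := D.existsUnique_rep k
  obtain ⟨z, hz⟩ := hc.symm
  have hm : (0 : ℤ) < D.m := by exact_mod_cast D.m_pos
  refine ⟨i, hi, (z % D.m).toNat, ?_, ?_⟩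
  · have := Int.emod_lt_of_pos z hm
    omega
  · rw [← zpow_natCast, Int.toNat_of_nonneg (Int.emod_nonneg z hm.ne'), m, zpow_mod_orderOf, hz]

open Classical in
/-- The number of `j < m` with `σ^j i = k`. -/
def mult (i k : ι) : ℕ := ((Finset.range D.m).filter fun j => (D.perm ^ j) i = k).card

lemma mult_ne_zero {i k : ι} {j : ℕ} (hj : j < D.m) (h : (D.perm ^ j) i = k) : D.mult i k ≠ 0 :=
  Finset.card_ne_zero.mpr ⟨j, by simp [hj, h]⟩

lemma mult_self_ne_zero (i : ι) : D.mult i i ≠ 0 := D.mult_ne_zero D.m_pos rfl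

lemma sum_perm_pow {V : Type*} [AddCommGroup V] [Module ℂ V] (i : ι) (g : ι → V) :
    ∑ j ∈ Finset.range D.m, g ((D.perm ^ j) i) = ∑ k, (D.mult i k : ℂ) • g k := by
  classical
  rw [← Finset.sum_fiberwise (Finset.range D.m) (fun j => (D.perm ^ j) i)]
  refine Finset.sum_congr rfl fun k _ => ?_
  rw [Finset.sum_congr rfl fun j hj => by rw [(Finset.mem_filter.mp hj).2], Finset.sum_const,
    Nat.cast_smul_eq_nsmul]
  congr!

lemma proj_zero_of_map {y : ι → L} (hy : ∀ i, D.σ (y i) = y (D.perm i)) (i : ι) :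
    D.proj 0 (y i) = ∑ k, (D.mult i k : ℂ) • y k := by
  rw [D.proj_of_map hy, ← sum_perm_pow]
  simp

lemma lie_e_f (i j : ι) [DecidableEq ι] : ⁅B.e i, B.f j⁆ = if i = j then B.h i else 0 := by
  split_ifs with h
  · rw [← h, (B.sl2 i).lie_e_f]
  · exact B.lie_e_f_ne i j h

/-- Only the term `f_k` of the orbit sum pairs with `e_k`, so one coroot is isolated from an
invariant element. -/
lemma lie_e_proj_f (i k : ι) : ⁅B.e k, D.proj 0 (B.f i)⁆ = (D.mult i k : ℂ) • B.h k := by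
  classical
  rw [D.proj_zero_of_map D.map_f, lie_sum]
  simp only [lie_smul, lie_e_f, smul_ite, smul_zero]
  simp

/-- The element of the Cartan subalgebra with coordinates `c`. -/
def cartanElt (B : LieAlgebra.Basis ι H) (c : ι → ℂ) : L := ∑ l, c l • B.h l

lemma cartanElt_lie_e (c : ι → ℂ) (k : ι) :
    ⁅cartanElt B c, B.e k⁆ = (∑ l, (B.A k l : ℂ) * c l) • B.e k := by
  rw [cartanElt, sum_lie, Finset.sum_smul]
  refine Finset.sum_congr rfl fun l _ => ?_
  rw [smul_lie, B.lie_h_e, ← Int.cast_smul_eq_zsmul ℂ, smul_smul, mul_comm]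

lemma cartanElt_lie_f (c : ι → ℂ) (k : ι) :
    ⁅cartanElt B c, B.f k⁆ = -(∑ l, (B.A k l : ℂ) * c l) • B.f k := by
  rw [cartanElt, sum_lie, ← Finset.sum_neg_distrib, Finset.sum_smul]
  refine Finset.sum_congr rfl fun l _ => ?_
  rw [smul_lie, B.lie_h_f, ← Int.cast_smul_eq_zsmul ℂ, smul_smul]
  congr 1
  push_cast
  ring

lemma det_map_ne_zero [DecidableEq ι] : (B.A.map ((↑) : ℤ → ℂ)).det ≠ 0 := by
  have h := B.nondegen.det_ne_zero
  have h1 : (B.A.map ((↑) : ℤ → ℂ)).det = (B.A.det : ℂ) :=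
    ((Int.castRingHom ℂ).map_det B.A).symm
  rw [h1]
  exact_mod_cast h

lemma exists_cartan_coord (B : LieAlgebra.Basis ι H) (v : ι → ℂ) :
    ∃ c : ι → ℂ, ∀ k, ∑ l, (B.A k l : ℂ) * c l = v k := by
  classical
  have hu : IsUnit (B.A.map ((↑) : ℤ → ℂ)).det := isUnit_iff_ne_zero.mpr det_map_ne_zero
  refine ⟨(B.A.map ((↑) : ℤ → ℂ))⁻¹.mulVec v, fun k => ?_⟩
  have h := congrFun (Matrix.mulVec_mulVec v (B.A.map ((↑) : ℤ → ℂ)) (B.A.map ((↑) : ℤ → ℂ))⁻¹) k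
  rw [Matrix.mul_nonsing_inv _ hu, Matrix.one_mulVec] at h
  exact h

lemma proj_h (i : ι) : D.proj 0 (B.h i) = cartanElt B fun l => (D.mult i l : ℂ) :=
  D.proj_zero_of_map D.map_h i

/-- The number `∑_j a_{k,σ^j i}`. -/
def orbitSum (i k : ι) : ℂ := ∑ l, (B.A k l : ℂ) * D.mult i l

/-- If it vanished, the averaged `e_i`, `f_i` and their bracket `h` would form a Heisenberg triple,
so `ad h` would have no nonzero eigenvalue. Its eigenvalues on the `e_k` would then all be zero, and
the multiplicities of the orbit would be a nonzero vector in the kernel of the Cartan matrix. -/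
lemma orbitSum_self_ne_zero [Module.Finite ℂ L] (i : ι) : D.orbitSum i i ≠ 0 := by
  classical
  intro h0
  have hd : (D.mult i i : ℂ) ≠ 0 := Nat.cast_ne_zero.mpr (D.mult_self_ne_zero i)
  set h := (D.mult i i : ℂ) • D.proj 0 (B.h i)
  set e := D.proj 0 (B.e i)
  set f := D.proj 0 (B.f i)
  have hef : ⁅e, f⁆ = h := by
    rw [lie_proj_proj, lie_e_proj_f, map_smul, add_zero]
  have hhe : ⁅e, h⁆ = 0 := by
    rw [lie_smul, lie_proj_proj, ← lie_skew, proj_h, cartanElt_lie_e]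
    change _ • D.proj (0 + 0) (-(D.orbitSum i i • _)) = 0
    rw [h0, zero_smul, neg_zero, map_zero, smul_zero]
  have hhf : ⁅f, h⁆ = 0 := by
    rw [lie_smul, lie_proj_proj, ← lie_skew, proj_h, cartanElt_lie_f]
    change _ • D.proj (0 + 0) (-(-(D.orbitSum i i) • _)) = 0
    rw [h0, neg_zero, zero_smul, neg_zero, map_zero, smul_zero]
  have hcomm : ∀ x y : L, ⁅x, y⁆ = 0 → Commute (LieAlgebra.ad ℂ L y) (LieAlgebra.ad ℂ L x) := by
    intro x y hxy
    ext v
    have := lie_lie x y v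
    rw [hxy, zero_lie] at this
    exact (sub_eq_zero.mp this.symm).symm
  have hk : ∀ k, D.orbitSum i k = 0 := by
    intro k
    have h1 : ⁅h, B.e k⁆ = ((D.mult i i : ℂ) * D.orbitSum i k) • B.e k := by
      rw [smul_lie, proj_h, cartanElt_lie_e, smul_smul]
      rfl
    have h2 := eigenvalue_eq_zero_of_commutator (e := LieAlgebra.ad ℂ L e)
      (f := LieAlgebra.ad ℂ L f) (h := LieAlgebra.ad ℂ L h) ?_ (hcomm e h hhe) (hcomm f h hhf)
      (B.sl2 k).e_ne_zero h1
    · exact (mul_eq_zero.mp h2).resolve_left hd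
    · ext v
      have := lie_lie e f v
      rw [hef] at this
      exact this.symm
  have hv := Matrix.eq_zero_of_mulVec_eq_zero (M := B.A.map ((↑) : ℤ → ℂ)) det_map_ne_zero
    (v := fun l => (D.mult i l : ℂ)) (funext hk)
  exact hd (congrFun hv i)

lemma loop_sigma_pow (r : ℤ) (j : ℕ) (x : L) :
    D.loop r ((D.sigma ^ j) x) = ((D.ζ ^ (-(j * r)) : ℂˣ) : ℂ) • D.loop r x := by
  induction j with
  | zero => simp
  | succ j ih =>
    rw [pow_succ', Module.End.mul_apply, sigma_apply, loop_sigma, ih, smul_smul, ← Units.val_mul,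
      ← zpow_add]
    congr 3
    push_cast
    ring

/-! ### Recurrences for the loops acting on a highest weight generator. -/

section Module

variable {W : Type*} [AddCommGroup W] [Module ℂ W] [LieRingModule D.twistedLoop W]
  [LieModule ℂ D.twistedLoop W]

/-- A cyclic module for the twisted loop algebra whose generator is an integrable highest weight
vector, with recurrent eigenvalues for the loops on the Cartan subalgebra. -/
structure IsWeylGenerator (w : W) : Prop where
  cyclic : ∀ N : Submodule ℂ W, w ∈ N → (∀ x : D.twistedLoop, ∀ v ∈ N, ⁅x, v⁆ ∈ N) → N = ⊤
  nPlus : ∀ x : D.twistedLoop,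
    (x : LieAlgebra.loopAlgebra ℂ ℤ L) ∈ loopNPlus (B := B) → ⁅x, w⁆ = 0
  cartan : ∀ i ∈ D.I₀, ∀ r, ∃ c : ℂ, ⁅D.loop r (B.h i), w⁆ = c • w
  cartan_recurrent : ∀ i ∈ D.I₀, (fun r => ⁅D.loop r (B.h i), w⁆) ∈ recurrent (V := W) D.period
  xMinus : ∀ i ∈ D.I₀, ∃ n : ℕ, ((LieModule.toEnd ℂ D.twistedLoop W (D.loop 0 (B.f i))) ^ (n + 1)) w = 0

variable {D} in
/-- The map `x ↦ ⁅x, v⁆`. -/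
def actOn (v : W) : D.twistedLoop →ₗ[ℂ] W where
  toFun x := ⁅x, v⁆
  map_add' _ _ := add_lie _ _ _
  map_smul' _ _ := smul_lie _ _ _

lemma polyLoop_lie (b : ℂ[X]) (r : ℤ) (x : L) (v : W) :
    ⁅D.polyLoop b r x, v⁆ = polyShift D.period b (fun k => ⁅D.loop k x, v⁆) r := by
  rw [polyLoop_eq_polyShift]
  exact polyShift_map _ _ (actOn v) _ _

variable (W) in
/-- The action of `polyLoop b 0 x` as a linear function of `b`. -/
def polyAct (x : L) : ℂ[X] →ₗ[ℂ] Module.End ℂ W where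
  toFun b := LieModule.toEnd ℂ D.twistedLoop W (D.polyLoop b 0 x)
  map_add' b c := by
    ext v
    simp only [LieModule.toEnd_apply_apply, LinearMap.add_apply, polyLoop_lie, polyShift, map_add,
      Pi.add_apply]
  map_smul' a b := by
    ext v
    simp only [LieModule.toEnd_apply_apply, LinearMap.smul_apply, polyLoop_lie, polyShift, map_smul,
      Pi.smul_apply, RingHom.id_apply]

lemma polyAct_apply (x : L) (b : ℂ[X]) (v : W) : D.polyAct W x b v = ⁅D.polyLoop b 0 x, v⁆ := rfl

/-- The elements `x` for which `r ↦ ⁅loop r x, w⁆` is recurrent. -/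
def recurrentSubalgebra (w : W) : LieSubalgebra ℂ L where
  carrier := {x | (fun r => ⁅D.loop r x, w⁆) ∈ recurrent (V := W) D.period}
  zero_mem' := by
    change _ ∈ recurrent (V := W) D.period
    simp only [map_zero, zero_lie]
    exact zero_mem (recurrent (V := W) D.period)
  add_mem' := by
    intro x y hx hy
    have := (recurrent (V := W) D.period).add_mem hx hy
    change _ ∈ recurrent (V := W) D.period
    simp only [map_add, add_lie]
    exact this
  smul_mem' := by
    intro c x hx
    have := (recurrent (V := W) D.period).smul_mem c hx
    change _ ∈ recurrent (V := W) D.period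
    simp only [map_smul, smul_lie]
    exact this
  lie_mem' := by
    rintro x y ⟨b, hb, hx⟩ ⟨c, hc, hy⟩
    refine ⟨b * c, mul_ne_zero hb hc, ?_⟩
    ext r
    rw [← polyLoop_lie]
    -- The `b c`-multiple of a loop on `⁅x, y⁆` is a sum of brackets of two elements that each kill
    -- `w`.
    have h1 : (D.m : ℂ) • D.polyLoop (b * c) r ⁅x, y⁆ =
        ∑ s ∈ Finset.range D.m, ⁅D.polyLoop b (r - s) x, D.polyLoop c s y⁆ := by
      simp only [lie_polyLoop_polyLoop, sub_add_cancel]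
      rw [← map_sum, ← lie_sum, sum_proj, lie_smul, map_smul]
    have h2 : (D.m : ℂ) • ⁅D.polyLoop (b * c) r ⁅x, y⁆, w⁆ = 0 := by
      rw [← smul_lie, h1, sum_lie]
      refine Finset.sum_eq_zero fun s _ => ?_
      rw [lie_lie, polyLoop_lie _ _ _ _ w, hy, polyLoop_lie _ _ _ _ w, hx]
      simp
    exact (smul_eq_zero.mp h2).resolve_left (Nat.cast_ne_zero.mpr D.m_pos.ne')

lemma mem_recurrentSubalgebra {w : W} {x : L} : x ∈ D.recurrentSubalgebra w ↔
    (fun r => ⁅D.loop r x, w⁆) ∈ recurrent (V := W) D.period := Iff.rfl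

lemma loop_e_mem_loopNPlus (k : ι) (r : ℤ) :
    (D.loop r (B.e k) : LieAlgebra.loopAlgebra ℂ ℤ L) ∈ loopNPlus (B := B) := by
  refine Submodule.subset_span ⟨D.proj r (B.e k), ?_, r, rfl⟩
  rw [D.proj_of_map D.map_e]
  refine sum_mem fun j _ => ?_
  refine Submodule.smul_mem B.borelUpper.toSubmodule _ ?_
  exact LieSubalgebra.subset_lieSpan ⟨_, rfl⟩

variable {D} {w : W}

lemma IsWeylGenerator.cartan_h (hw : D.IsWeylGenerator w) (k : ι) (r : ℤ) :
    ∃ c : ℂ, ⁅D.loop r (B.h k), w⁆ = c • w := by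
  obtain ⟨i, hi, j, -, rfl⟩ := D.exists_rep k
  obtain ⟨c, hc⟩ := hw.cartan i hi r
  exact ⟨_, by rw [← D.sigma_pow_of_map D.map_h, loop_sigma_pow, smul_lie, hc, smul_smul]⟩

lemma IsWeylGenerator.cartan_cartanElt (hw : D.IsWeylGenerator w) (c : ι → ℂ) (r : ℤ) :
    ∃ a : ℂ, ⁅D.loop r (cartanElt B c), w⁆ = a • w := by
  choose a ha using fun k => hw.cartan_h k r
  refine ⟨∑ l, c l * a l, ?_⟩
  rw [cartanElt, map_sum, sum_lie, Finset.sum_smul]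
  refine Finset.sum_congr rfl fun l _ => ?_
  rw [map_smul, smul_lie, ha, smul_smul]

lemma IsWeylGenerator.e_mem (hw : D.IsWeylGenerator w) (k : ι) :
    B.e k ∈ D.recurrentSubalgebra w := by
  rw [mem_recurrentSubalgebra]
  simp only [hw.nPlus _ (D.loop_e_mem_loopNPlus k _)]
  exact zero_mem (recurrent (V := W) D.period)

/-- Only degrees divisible by the period enter, so the loops on `e_i`, `f_i` and the multiple `mult
i i` of `h_i` satisfy the `𝔰𝔩₂` relations, also at a middle node. The recurrence for `h_i` supplies
the polynomial `b` of the lowering lemma. -/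
lemma IsWeylGenerator.exists_polyLoop_f_lie_eq_zero [Module.Finite ℂ L]
    (hw : D.IsWeylGenerator w) {i : ι} (hi : i ∈ D.I₀) :
    ∃ b : ℂ[X], b ≠ 0 ∧ ⁅D.polyLoop b 0 (B.f i), w⁆ = 0 := by
  obtain ⟨b, hb, hbw⟩ := hw.cartan_recurrent i hi
  obtain ⟨n, hn⟩ := hw.xMinus i hi
  refine ⟨b ^ n, pow_ne_zero n hb, ?_⟩
  have hd : (D.mult i i : ℂ) ≠ 0 := Nat.cast_ne_zero.mpr (D.mult_self_ne_zero i)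
  refine lowering_pow_apply_eq_zero (E := D.polyAct W (B.e i)) (F := D.polyAct W (B.f i))
    (H := D.polyAct W ((D.mult i i : ℂ) • B.h i))
    (q := (D.mult i i : ℂ) * D.orbitSum i i) ?_ ?_ (mul_ne_zero hd (D.orbitSum_self_ne_zero i))
    ?_ ?_ (n := n) ?_
  · intro b c v
    simp only [polyAct_apply]
    rw [← D.lie_e_proj_f i i, leibniz_lie, lie_polyLoop_polyLoop, add_zero, add_comm]
  · intro b c v
    simp only [polyAct_apply]
    have h1 : ⁅D.polyLoop b 0 ((D.mult i i : ℂ) • B.h i), D.polyLoop c 0 (B.f i)⁆ =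
        -(((D.mult i i : ℂ) * D.orbitSum i i) • D.polyLoop (b * c) 0 (B.f i)) := by
      rw [← lie_skew, lie_polyLoop_polyLoop, map_smul, lie_smul, ← lie_skew (B.f i), proj_h,
        cartanElt_lie_f, add_zero, mul_comm c b, map_smul, map_neg, map_smul]
      change -(_ • -(-D.orbitSum i i • _)) = _
      module
    rw [leibniz_lie, h1, neg_lie, smul_lie]
    abel
  · intro c
    rw [polyAct_apply, map_smul, smul_lie, polyLoop_lie, mul_comm, polyShift_mul, hbw,
      polyShift_zero]
    simp
  · rw [polyAct_apply, polyLoop_lie]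
    simp only [hw.nPlus _ (D.loop_e_mem_loopNPlus i _)]
    exact congrFun (polyShift_zero (V := W) D.period b) 0
  · have h1 : D.polyAct W (B.f i) 1 = LieModule.toEnd ℂ D.twistedLoop W (D.loop 0 (B.f i)) := by
      ext v
      rw [polyAct_apply, polyLoop_one]
      rfl
    rw [h1, hn]

/-- Every `f k` is obtained from the invariant element attached to its orbit by the action of the
Cartan subalgebra. -/
lemma exists_cartanElt_lie_proj_f {i k : ι} (h : D.mult i k ≠ 0) :
    ∃ c : ι → ℂ, ⁅cartanElt B c, D.proj 0 (B.f i)⁆ = B.f k := by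
  classical
  -- These weights kill the other terms of the orbit sum and cancel the multiplicity of `f_k`; the
  -- sign is that of a negative root.
  obtain ⟨c, hc⟩ := exists_cartan_coord B fun l => if l = k then -(D.mult i k : ℂ)⁻¹ else 0
  refine ⟨c, ?_⟩
  rw [D.proj_zero_of_map D.map_f, lie_sum]
  simp only [lie_smul, cartanElt_lie_f, hc]
  rw [Finset.sum_eq_single_of_mem k (Finset.mem_univ k)]
  · have : (D.mult i k : ℂ) ≠ 0 := Nat.cast_ne_zero.mpr h
    rw [if_pos rfl, neg_neg, smul_smul, mul_inv_cancel₀ this, one_smul]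
  · intro l _ hl
    rw [if_neg hl, neg_zero, zero_smul, smul_zero]

/-- Bracketing the degree-zero annihilator `b f_i` with Cartan loops reaches every degree and every
node of the orbit. Since `w` is an eigenvector of the Cartan loops, the result still kills `w`. -/
lemma IsWeylGenerator.f_mem [Module.Finite ℂ L] (hw : D.IsWeylGenerator w) (k : ι) :
    B.f k ∈ D.recurrentSubalgebra w := by
  obtain ⟨i, hi, j, hj, hk⟩ := D.exists_rep k
  obtain ⟨b, hb, hbw⟩ := hw.exists_polyLoop_f_lie_eq_zero hi
  obtain ⟨c, hc⟩ := exists_cartanElt_lie_proj_f (D.mult_ne_zero hj hk)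
  refine ⟨b, hb, ?_⟩
  ext r
  obtain ⟨a, ha⟩ := hw.cartan_cartanElt c r
  have h1 := D.lie_polyLoop_polyLoop 1 b r 0 (cartanElt B c) (B.f i)
  rw [hc, one_mul, add_zero, polyLoop_one] at h1
  rw [← polyLoop_lie, ← h1, lie_lie, hbw, ha, lie_smul, hbw]
  simp

lemma IsWeylGenerator.exists_polyLoop_lie_eq_zero [Module.Finite ℂ L]
    (hw : D.IsWeylGenerator w) :
    ∃ b : ℂ[X], b ≠ 0 ∧ ∀ (r : ℤ) (x : L) (v : W), ⁅D.polyLoop b r x, v⁆ = 0 := by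
  let Φ : L →ₗ[ℂ] (ℤ → W) := LinearMap.pi fun r => (actOn w).comp (D.loop r)
  obtain ⟨b, hb, h⟩ := exists_common_recurrence (M := D.period) Φ fun x =>
    mem_of_generators (D.recurrentSubalgebra w) hw.e_mem hw.f_mem x
  refine ⟨b, hb, ?_⟩
  -- The `b`-multiples of loops are stable under brackets with all loops, so the vectors they kill
  -- form a submodule, and it contains `w`.
  let N : Submodule ℂ W :=
    { carrier := {v | ∀ (r : ℤ) (x : L), ⁅D.polyLoop b r x, v⁆ = 0}
      zero_mem' := fun r x => lie_zero _
      add_mem' := fun hu hv r x => by rw [lie_add, hu, hv, add_zero]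
      smul_mem' := fun c v hv r x => by rw [lie_smul, hv, smul_zero] }
  have hN : N = ⊤ := by
    refine hw.cyclic N (fun r x => ?_) (fun z v hv r x => ?_)
    · rw [polyLoop_lie]
      exact congrFun (h x) r
    · have hz : z ∈ Submodule.span ℂ {z | ∃ r x, z = D.loop r x} :=
        D.span_loop ▸ Submodule.mem_top
      induction hz using Submodule.span_induction with
      | zero => rw [zero_lie, lie_zero]
      | add y z _ _ hy hz => rw [add_lie, lie_add, hy, hz, add_zero]
      | smul c z _ hz => rw [smul_lie, lie_smul, hz, smul_zero]
      | mem z hz =>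
        obtain ⟨s, y, rfl⟩ := hz
        rw [leibniz_lie, lie_polyLoop_loop, hv, hv, lie_zero, add_zero]
  intro r x v
  have hv : v ∈ N := hN ▸ Submodule.mem_top
  exact hv r x

end Module

end DiagramAutomorphism
end TwistedLoop
end

/-! ### The finite-dimensional image, and its spanning set of nilpotent elements. -/

noncomputable section
namespace TwistedLoop
namespace DiagramAutomorphism

variable {ι L : Type*} [Fintype ι] [LieRing L] [LieAlgebra ℂ L]
  {H : LieSubalgebra ℂ L} {B : LieAlgebra.Basis ι H} {D : DiagramAutomorphism B}

section Module

attribute [local instance] LieRing.ofAssociativeRing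

variable {W : Type*} [AddCommGroup W] [Module ℂ W] [LieRingModule D.twistedLoop W]
  [LieModule ℂ D.twistedLoop W] {w : W}

/-- The height grading is invariant under permutations of the simple roots, so all `σ`-images of its
element act alike on the generators. The nonzero eigenvalues give ad-nilpotency in the
finite-dimensional image. -/
lemma exists_grading_elt (D : DiagramAutomorphism B) : ∃ g : L,
    (∀ k, ⁅B.e k, D.proj 0 g⁆ = -(D.m : ℂ) • B.e k) ∧
      ∀ k, ⁅B.f k, D.proj 0 g⁆ = (D.m : ℂ) • B.f k := by
  obtain ⟨c, hc⟩ := exists_cartan_coord B fun _ => 1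
  have he : ∀ (j : ℕ) k, ⁅(D.sigma ^ j) (cartanElt B c), B.e k⁆ = B.e k := by
    intro j k
    obtain ⟨k', rfl⟩ := (D.perm ^ j).surjective k
    rw [← D.sigma_pow_of_map D.map_e, ← sigma_pow_lie, cartanElt_lie_e, hc, one_smul]
  have hf : ∀ (j : ℕ) k, ⁅(D.sigma ^ j) (cartanElt B c), B.f k⁆ = -B.f k := by
    intro j k
    obtain ⟨k', rfl⟩ := (D.perm ^ j).surjective k
    rw [← D.sigma_pow_of_map D.map_f, ← sigma_pow_lie, cartanElt_lie_f, hc, neg_smul, one_smul,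
      map_neg]
  refine ⟨cartanElt B c, fun k => ?_, fun k => ?_⟩
  · rw [proj_apply, ← lie_skew, sum_lie]
    simp [he, Nat.cast_smul_eq_nsmul]
  · rw [proj_apply, ← lie_skew, sum_lie]
    simp [hf, Nat.cast_smul_eq_nsmul]

lemma IsWeylGenerator.finite_range [Module.Finite ℂ L] (hw : D.IsWeylGenerator w) :
    FiniteDimensional ℂ (LieModule.toEnd ℂ D.twistedLoop W).range := by
  obtain ⟨b, hb, h⟩ := hw.exists_polyLoop_lie_eq_zero
  set φ := LieModule.toEnd ℂ D.twistedLoop W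
  have h1 : ∀ x : L, FiniteDimensional ℂ (Submodule.span ℂ (Set.range fun r => φ (D.loop r x))) := by
    intro x
    refine finite_span_range_of_polyShift D.period_pos hb ?_
    ext r v
    have h2 := polyShift_map D.period b (φ : D.twistedLoop →ₗ[ℂ] Module.End ℂ W)
      (fun k => D.loop k x) r
    rw [← polyLoop_eq_polyShift] at h2
    exact (LinearMap.congr_fun h2 v).symm.trans (h r x v)
  obtain ⟨s, hs⟩ := (Module.Finite.fg_top : (⊤ : Submodule ℂ L).FG)
  set N : Submodule ℂ (Module.End ℂ W) :=
    ⨆ x : s, Submodule.span ℂ (Set.range fun r => φ (D.loop r (x : L)))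
  have h2 : ∀ r x, φ (D.loop r x) ∈ N := by
    intro r x
    have hx : x ∈ Submodule.span ℂ (s : Set L) := hs ▸ Submodule.mem_top
    induction hx using Submodule.span_induction with
    | zero => rw [map_zero, map_zero]; exact zero_mem _
    | add x y _ _ hx hy => rw [map_add, map_add]; exact add_mem hx hy
    | smul c x _ hx => rw [map_smul, map_smul]; exact Submodule.smul_mem _ c hx
    | mem x hx =>
      exact Submodule.mem_iSup_of_mem (⟨x, hx⟩ : s) (Submodule.subset_span ⟨r, rfl⟩)
  have h3 : φ.range.toSubmodule ≤ N := by
    rintro _ ⟨z, rfl⟩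
    have hz : z ∈ Submodule.span ℂ {z | ∃ r x, z = D.loop r x} :=
      D.span_loop ▸ Submodule.mem_top
    change φ z ∈ N
    induction hz using Submodule.span_induction with
    | zero => rw [map_zero]; exact zero_mem _
    | add y z _ _ hy hz => rw [map_add]; exact add_mem hy hz
    | smul c z _ hz => rw [map_smul]; exact Submodule.smul_mem _ c hz
    | mem z hz =>
      obtain ⟨r, x, rfl⟩ := hz
      exact h2 r x
  exact Submodule.finiteDimensional_of_le h3

lemma IsWeylGenerator.mem_nilSpan [Module.Finite ℂ L] (hw : D.IsWeylGenerator w)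
    (z : D.twistedLoop) : (LieModule.toEnd ℂ D.twistedLoop W).rangeRestrict z ∈
      nilSpan ℂ W (LieModule.toEnd ℂ D.twistedLoop W).range := by
  have := hw.finite_range
  set π := (LieModule.toEnd ℂ D.twistedLoop W).rangeRestrict with hπ
  set S := nilSpan ℂ W (LieModule.toEnd ℂ D.twistedLoop W).range
  have hcyc : ∀ N : Submodule ℂ W, w ∈ N →
      (∀ x : (LieModule.toEnd ℂ D.twistedLoop W).range, ∀ v ∈ N, ⁅x, v⁆ ∈ N) → N = ⊤ :=
    fun N hN h => hw.cyclic N hN fun x v hv => h (π x) v hv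
  have hnil : ∀ (x y : D.twistedLoop) (c : ℂ) (k : ℕ), c ≠ 0 → ⁅y, x⁆ = c • x →
      ((LieModule.toEnd ℂ D.twistedLoop W x) ^ k) w = 0 → π x ∈ S := by
    intro x y c k hc hxy hk
    have h1 : IsLocallyNilpotent (LieAlgebra.ad ℂ _ (π x)) :=
      isLocallyNilpotent_ad (h := π y) hc (by rw [← LieHom.map_lie, hxy, map_smul])
    exact Submodule.subset_span ⟨h1, isLocallyNilpotent_toEnd h1 (k := k) hk hcyc⟩
  obtain ⟨g, hge, hgf⟩ := exists_grading_elt D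
  have hm : (D.m : ℂ) ≠ 0 := Nat.cast_ne_zero.mpr D.m_pos.ne'
  have he : ∀ r k, π (D.loop r (B.e k)) ∈ S := by
    intro r k
    refine hnil _ (D.loop 0 g) (D.m : ℂ) 1 hm ?_ ?_
    · rw [← lie_skew, lie_loop_loop, hge, add_zero, map_smul, neg_smul, neg_neg]
    · rw [pow_one]
      exact hw.nPlus _ (D.loop_e_mem_loopNPlus k r)
  have hf0 : ∀ i ∈ D.I₀, π (D.loop 0 (B.f i)) ∈ S := by
    intro i hi
    obtain ⟨n, hn⟩ := hw.xMinus i hi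
    refine hnil _ (D.loop 0 g) (-(D.m : ℂ)) (n + 1) (neg_ne_zero.mpr hm) ?_ hn
    rw [← lie_skew, lie_loop_loop, hgf, add_zero, map_smul, neg_smul]
  -- Brackets of loops on `e_k` with degree-zero lowering elements give all Cartan loops. These in
  -- turn give all loops on `f_k`, whose nilpotency on `w` was not assumed outside degree zero.
  have hh : ∀ r k, π (D.loop r (B.h k)) ∈ S := by
    intro r k
    obtain ⟨i, hi, j, hj, hk⟩ := D.exists_rep k
    have h1 := S.lie_mem (he r k) (hf0 i hi)
    rw [← LieHom.map_lie, lie_loop_loop, lie_e_proj_f, add_zero, map_smul, map_smul] at h1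
    exact (Submodule.smul_mem_iff S.toSubmodule
      (Nat.cast_ne_zero.mpr (D.mult_ne_zero hj hk))).mp h1
  have hf : ∀ r k, π (D.loop r (B.f k)) ∈ S := by
    intro r k
    obtain ⟨i, hi, j, hj, hk⟩ := D.exists_rep k
    obtain ⟨c, hc⟩ := exists_cartanElt_lie_proj_f (D.mult_ne_zero hj hk)
    have h0 : π (D.loop r (cartanElt B c)) ∈ S := by
      rw [cartanElt, map_sum, map_sum]
      refine sum_mem fun l _ => ?_
      rw [map_smul, map_smul]
      exact S.smul_mem _ (hh r l)
    have h1 := S.lie_mem h0 (hf0 i hi)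
    rwa [← LieHom.map_lie, lie_loop_loop, hc, add_zero] at h1
  let T : LieSubalgebra ℂ L :=
    { carrier := {x | ∀ r, π (D.loop r x) ∈ S}
      zero_mem' := fun r => by rw [map_zero, map_zero]; exact S.zero_mem
      add_mem' := fun hx hy r => by rw [map_add, map_add]; exact S.add_mem (hx r) (hy r)
      smul_mem' := fun c x hx r => by rw [map_smul, map_smul]; exact S.smul_mem c (hx r)
      lie_mem' := by
        intro x y hx hy r
        have h1 : (D.m : ℂ) • D.loop r ⁅x, y⁆ =
            ∑ s ∈ Finset.range D.m, ⁅D.loop (r - s) x, D.loop s y⁆ := by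
          simp only [lie_loop_loop, sub_add_cancel]
          rw [← map_sum, ← lie_sum, sum_proj, lie_smul, map_smul]
        have h2 : (D.m : ℂ) • π (D.loop r ⁅x, y⁆) ∈ S := by
          rw [← map_smul, h1, map_sum]
          refine sum_mem fun s _ => ?_
          rw [LieHom.map_lie]
          exact S.lie_mem (hx _) (hy _)
        exact (Submodule.smul_mem_iff S.toSubmodule hm).mp h2 }
  have hT : ∀ x, x ∈ T := mem_of_generators T (fun k r => he r k) (fun k r => hf r k)
  have hz : z ∈ Submodule.span ℂ {z | ∃ r x, z = D.loop r x} :=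
    D.span_loop ▸ Submodule.mem_top
  induction hz using Submodule.span_induction with
  | zero => rw [map_zero]; exact S.zero_mem
  | add y z _ _ hy hz => rw [map_add]; exact S.add_mem hy hz
  | smul c z _ hz => rw [map_smul]; exact S.smul_mem c hz
  | mem z hz =>
    obtain ⟨r, x, rfl⟩ := hz
    exact hT x r

theorem IsWeylGenerator.finite [Module.Finite ℂ L] (hw : D.IsWeylGenerator w) :
    Module.Finite ℂ W := by
  have := hw.finite_range
  set A := (LieModule.toEnd ℂ D.twistedLoop W).range with hA
  have htop : Submodule.span ℂ (nilElements ℂ W A) = ⊤ := by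
    rw [eq_top_iff]
    rintro ⟨_, ⟨z, rfl⟩⟩ _
    exact hw.mem_nilSpan z
  -- Finite dimension of the image allows a finite spanning set chosen among the nilpotent elements
  -- themselves.
  obtain ⟨s, hs, hspan⟩ := (Submodule.fg_span_iff_fg_span_finset_subset (nilElements ℂ W A)).mp
    (htop ▸ Module.Finite.fg_top)
  refine finite_of_pow_apply_eq_zero (K := ℂ) (A := A) (κ := s) (y := fun i => (i : A)) (w := w)
    ?_ (fun i => (hs i.2).2 w) ?_
  · rw [← htop, hspan]
    congr 1
    simp
  · exact fun N hN h => hw.cyclic N hN fun x v hv =>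
      h ((LieModule.toEnd ℂ D.twistedLoop W).rangeRestrict x) v hv

end Module

end DiagramAutomorphism
end TwistedLoop
end

/-! ### The generator of the twisted Weyl module satisfies the hypotheses. -/

noncomputable section
namespace TwistedLoop

lemma minus_revProd {R : Multiset ℂ} (hR : ∀ a ∈ R, a ≠ 0) :
    minus (revProd R) = revProd (R.map fun a => a⁻¹) := by
  induction R using Multiset.induction_on with
  | empty => simp [minus, revProd, Polynomial.reverse]
  | cons a R ih =>
    have h : ∀ (b : ℂ) (T : Multiset ℂ), revProd (b ::ₘ T) =
        (1 - Polynomial.C b * Polynomial.X) * revProd T := by simp [revProd]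
    rw [Multiset.map_cons, h, h, minus_mul, minus_one_sub a (hR a (Multiset.mem_cons_self a R)),
      ih fun b hb => hR b (Multiset.mem_cons_of_mem hb)]

lemma natDegree_revProd {R : Multiset ℂ} (hR : ∀ a ∈ R, a ≠ 0) :
    (revProd R).natDegree = R.card := by
  have h1 : ∀ a ∈ R, (1 - Polynomial.C a * Polynomial.X : ℂ[X]).natDegree = 1 := by
    intro a ha
    rw [sub_eq_neg_add, ← neg_mul, ← Polynomial.C_neg, ← Polynomial.C_1]
    exact Polynomial.natDegree_linear (neg_ne_zero.mpr (hR a ha))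
  rw [revProd, Polynomial.natDegree_multiset_prod, Multiset.map_map]
  · have h2 : R.map (Polynomial.natDegree ∘ fun a => 1 - Polynomial.C a * Polynomial.X) =
        R.map fun _ => 1 := Multiset.map_congr rfl h1
    rw [h2]
    simp
  · intro h
    obtain ⟨a, ha, h0⟩ := Multiset.mem_map.mp h
    have := h1 a ha
    rw [h0] at this
    simp at this

namespace DiagramAutomorphism

variable {ι L : Type*} [Fintype ι] [LieRing L] [LieAlgebra ℂ L]
  {H : LieSubalgebra ℂ L} {B : LieAlgebra.Basis ι H} (D : DiagramAutomorphism B)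

lemma exists_eq_revProd {p : D.I₀ → ℂ[X]} (hp : p ∈ D.polyMonoid) (i : D.I₀) :
    ∃ R : Multiset ℂ, (∀ a ∈ R, a ≠ 0) ∧ p i = revProd R := by
  classical
  induction hp using Submonoid.closure_induction with
  | one => exact ⟨0, by simp, by simp [revProd]⟩
  | mul p q _ _ hp hq =>
    obtain ⟨R, hR, h⟩ := hp
    obtain ⟨T, hT, h'⟩ := hq
    refine ⟨R + T, fun a ha => (Multiset.mem_add.mp ha).elim (hR a) (hT a), ?_⟩
    rw [Pi.mul_apply, h, h', revProd, revProd, revProd, Multiset.map_add, Multiset.prod_add]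
  | mem p hp =>
    obtain ⟨lam, -, a, ha, rfl⟩ := hp
    refine ⟨Multiset.replicate (if D.IsMiddle i then lam i / 2 else lam i)
      (if D.IsFixed i then a ^ D.m else a), fun b hb => ?_, ?_⟩
    · rw [Multiset.eq_of_mem_replicate hb]
      split_ifs
      · exact pow_ne_zero _ ha
      · exact ha
    · rw [revProd, Multiset.map_replicate, Multiset.prod_replicate, piTuple]

variable {D} in
lemma IsFixed.not_isMiddle {i : ι} (hi : D.IsFixed i) : ¬ D.IsMiddle i := by
  have := IsAddTorsionFree.of_isTorsionFree ℂ L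
  intro h
  rw [IsMiddle, hi, B.A_diag_eq_two] at h
  exact absurd h (by decide)

variable {D} in
lemma IsFixed.perm_pow {i : ι} (hi : D.IsFixed i) (j : ℕ) : (D.perm ^ j) i = i := by
  induction j with
  | zero => rfl
  | succ j ih => rw [pow_succ', Equiv.Perm.mul_apply, ih, hi]

lemma proj_eq_comp {y : ι → L} (hy : ∀ i, D.σ (y i) = y (D.perm i)) {i : ι}
    (hi : ¬ D.IsFixed i) (r : ℤ) : D.proj r (y i) = D.comp y i (-r) := by
  rw [D.proj_of_map hy, comp, if_neg hi]
  simp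

lemma sum_zeta_zpow (r : ℤ) (h : ¬ (D.m : ℤ) ∣ r) :
    ∑ j ∈ Finset.range D.m, ((D.ζ ^ (j * r) : ℂˣ) : ℂ) = 0 := by
  have h1 : ((D.ζ ^ r : ℂˣ) : ℂ) ≠ 1 := by
    intro h0
    exact h ((D.isPrimitiveRoot.zpow_eq_one_iff_dvd r).mp (Units.ext h0))
  have h2 : ((D.ζ ^ r : ℂˣ) : ℂ) ^ D.m = 1 := by
    rw [← Units.val_pow_eq_pow_val, ← zpow_natCast, ← zpow_mul,
      D.zeta_zpow_of_dvd (dvd_mul_left _ _), Units.val_one]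
  have h3 := mul_geom_sum ((D.ζ ^ r : ℂˣ) : ℂ) D.m
  rw [h2, sub_self] at h3
  rw [← (mul_eq_zero.mp h3).resolve_left (sub_ne_zero.mpr h1)]
  refine Finset.sum_congr rfl fun j _ => ?_
  rw [← Units.val_pow_eq_pow_val, ← zpow_natCast, ← zpow_mul, mul_comm]

open Classical in
lemma proj_eq_comp_of_isFixed {y : ι → L} (hy : ∀ i, D.σ (y i) = y (D.perm i)) {i : ι}
    (hi : D.IsFixed i) (r : ℤ) :
    D.proj r (y i) = (if (D.m : ℤ) ∣ r then (D.m : ℂ) else 0) • D.comp y i (-r) := by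
  rw [D.proj_of_map hy, comp, if_pos hi]
  simp only [hi.perm_pow, ← Finset.sum_smul, dvd_neg]
  split_ifs with h
  · congr 1
    rw [Finset.sum_congr rfl fun j _ => by
      rw [D.zeta_zpow_of_dvd (dvd_mul_of_dvd_right h _)]]
    simp
  · rw [sum_zeta_zpow D r h]
    simp

lemma loop_eq_smul_twTens {x y : L} {r : ℤ} {c : ℂ} (hy : D.σ y = ((D.ζ ^ (-r) : ℂˣ) : ℂ) • y)
    (h : D.proj r x = c • y) : D.loop r x = c • D.twTens y r hy := by
  apply Subtype.ext
  change tens (D.proj r x) r = c • tens y r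
  rw [h, tens_smul]

open Classical in
lemma loop_h_of_isFixed {i : ι} (hi : D.IsFixed i) (r : ℤ) :
    D.loop r (B.h i) = (if (D.m : ℤ) ∣ r then (D.m : ℂ) else 0) • D.hLoop i r := by
  apply loop_eq_smul_twTens
  rw [D.proj_eq_comp_of_isFixed D.map_h hi, hComp,
    if_neg (show ¬ (D.IsMiddle i ∧ (D.m : ℤ) ∣ -r) from fun h => hi.not_isMiddle h.1)]

open Classical in
lemma loop_h_of_not_isFixed {i : ι} (hi : ¬ D.IsFixed i) (r : ℤ) :
    D.loop r (B.h i) =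
      (if D.IsMiddle i ∧ (D.m : ℤ) ∣ r then (2 : ℂ)⁻¹ else 1) • D.hLoop i r := by
  apply loop_eq_smul_twTens
  rw [D.proj_eq_comp D.map_h hi, hComp]
  simp only [dvd_neg]
  split_ifs
  · rw [smul_smul, inv_mul_cancel₀ two_ne_zero, one_smul]
  · rw [one_smul]

lemma exists_loop_f_eq_smul (i : ι) : ∃ c : ℂ, D.loop 0 (B.f i) = c • D.xMinusLoop i := by
  have h2 : ((Real.sqrt 2 : ℝ) : ℂ) ≠ 0 := by simp
  by_cases hi : D.IsFixed i
  · refine ⟨D.m, D.loop_eq_smul_twTens _ ?_⟩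
    rw [D.proj_eq_comp_of_isFixed D.map_f hi, if_pos (dvd_zero _), neg_zero, xMinus,
      if_neg hi.not_isMiddle]
  · by_cases hm : D.IsMiddle i
    · refine ⟨((Real.sqrt 2 : ℝ) : ℂ)⁻¹, D.loop_eq_smul_twTens _ ?_⟩
      rw [D.proj_eq_comp D.map_f hi, xMinus, if_pos hm, neg_zero, smul_smul, inv_mul_cancel₀ h2,
        one_smul]
    · refine ⟨1, D.loop_eq_smul_twTens _ ?_⟩
      rw [D.proj_eq_comp D.map_f hi, xMinus, if_neg hm, neg_zero, one_smul]

section WeylModule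

attribute [local instance] LieRing.ofAssociativeRing

variable (p : D.I₀ → ℂ[X])

/-- The generator of the twisted Weyl module. -/
def weylGen : D.WeylModule p := Submodule.Quotient.mk 1

lemma smul_weylGen (u : D.U) :
    u • D.weylGen p = (Submodule.Quotient.mk u : D.WeylModule p) := by
  rw [weylGen, ← Submodule.Quotient.mk_smul, smul_eq_mul, mul_one]

variable {p} in
lemma WeylRelation.smul_eq_zero {u : D.U} (h : D.WeylRelation p u) : u • D.weylGen p = 0 := by
  rw [smul_weylGen, Submodule.Quotient.mk_eq_zero]
  exact Submodule.subset_span h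

variable {p} in
lemma WeylRelation.smul_eq_smul {u : D.U} {c : ℂ} (h : D.WeylRelation p (u - algebraMap ℂ D.U c)) :
    u • D.weylGen p = c • D.weylGen p := by
  have := h.smul_eq_zero
  rwa [sub_smul, sub_eq_zero, algebraMap_smul] at this

/-- The action of the twisted loop algebra on the Weyl module. -/
instance weylLieRingModule : LieRingModule D.twistedLoop (D.WeylModule p) where
  bracket x v := D.toU x • v
  add_lie x y v := by
    change D.toU (x + y) • v = D.toU x • v + D.toU y • v
    rw [toU, map_add, add_smul]
  lie_add x u v := smul_add _ _ _
  leibniz_lie x y v := by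
    change D.toU x • D.toU y • v = D.toU ⁅x, y⁆ • v + D.toU y • D.toU x • v
    rw [toU, toU, toU, LieHom.map_lie, LieRing.of_associative_ring_bracket, sub_smul, mul_smul,
      mul_smul, sub_add_cancel]

lemma weyl_lie (x : D.twistedLoop) (v : D.WeylModule p) : ⁅x, v⁆ = D.toU x • v := rfl

instance weylLieModule : LieModule ℂ D.twistedLoop (D.WeylModule p) where
  smul_lie c x v := by
    rw [weyl_lie, weyl_lie, toU, map_smul, smul_assoc]
  lie_smul c x v := by
    have := IsScalarTower.to_smulCommClass' (R := ℂ) (A := D.U) (M := D.WeylModule p)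
    rw [weyl_lie, weyl_lie, smul_comm]

lemma weyl_cyclic (N : Submodule ℂ (D.WeylModule p)) (hN : D.weylGen p ∈ N)
    (h : ∀ x : D.twistedLoop, ∀ v ∈ N, ⁅x, v⁆ ∈ N) : N = ⊤ := by
  let S : Subalgebra ℂ D.U :=
    { carrier := {u | ∀ v ∈ N, u • v ∈ N}
      mul_mem' := fun {a b} ha hb v hv => by rw [mul_smul]; exact ha _ (hb v hv)
      add_mem' := fun {a b} ha hb v hv => by rw [add_smul]; exact add_mem (ha v hv) (hb v hv)
      algebraMap_mem' := fun c v hv => by rw [algebraMap_smul]; exact N.smul_mem c hv }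
  let j : D.twistedLoop →ₗ⁅ℂ⁆ S :=
    { toFun := fun x => ⟨D.toU x, h x⟩
      map_add' := fun x y => Subtype.ext (map_add _ _ _)
      map_smul' := fun c x => Subtype.ext (map_smul _ _ _)
      map_lie' := fun {x y} => Subtype.ext (LieHom.map_lie _ _ _) }
  have hS : ∀ u : D.U, u ∈ S := by
    intro u
    -- The stabiliser of `N` contains the Lie algebra, so the universal property retracts the
    -- enveloping algebra onto it.
    have h1 : S.val.comp (UniversalEnvelopingAlgebra.lift ℂ j) = AlgHom.id ℂ D.U := by
      apply UniversalEnvelopingAlgebra.hom_ext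
      ext x
      change ((UniversalEnvelopingAlgebra.lift ℂ j (UniversalEnvelopingAlgebra.ι ℂ x) : S) : D.U) =
        UniversalEnvelopingAlgebra.ι ℂ x
      rw [UniversalEnvelopingAlgebra.lift_ι_apply]
      rfl
    have h2 := DFunLike.congr_fun h1 u
    rw [AlgHom.id_apply] at h2
    rw [← h2]
    exact (UniversalEnvelopingAlgebra.lift ℂ j u).2
  rw [eq_top_iff]
  intro v _
  obtain ⟨u, rfl⟩ := Submodule.Quotient.mk_surjective _ v
  rw [← smul_weylGen]
  exact hS u _ hN

variable {p}

lemma coeff_zero_logSeries (s : ℤ) (i : ι) : PowerSeries.coeff 0 (D.logSeries s i) = 0 := by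
  rw [logSeries, PowerSeries.coeff_mk, if_pos rfl]

lemma coeff_logSeries_smul {s : ℤ} {i : D.I₀} {T : Multiset ℂ}
    (h : ∀ k, D.WeylRelation p
      (PowerSeries.coeff k (D.pSeries s i) - algebraMap ℂ D.U ((revProd T).coeff k))) (k : ℕ) :
    PowerSeries.coeff k (D.logSeries s i) • D.weylGen p =
      (-((k : ℂ)⁻¹ * (T.map (· ^ k)).sum)) • D.weylGen p := by
  have h1 := coeff_smul_eq_of_expSeries (w := D.weylGen p) (D.coeff_zero_logSeries s i)
    (s := logProd T) (by simp [logProd]) (fun k => ?_) k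
  · rw [h1, logProd, PowerSeries.coeff_mk]
  · rw [expSeries_logProd, Polynomial.coeff_coe]
    exact (h k).smul_eq_smul

/-- The values of the coefficients of both series, for `k = s n` with `s = ± 1` and `n > 0`. -/
lemma exists_coeff_logSeries_smul {i : D.I₀} {R : Multiset ℂ} (hR : ∀ a ∈ R, a ≠ 0)
    (hp : p i = revProd R) {k : ℤ} (hk : k ≠ 0) :
    ∃ (s : ℤ) (n : ℕ), n ≠ 0 ∧ k = s * n ∧ (Even n ↔ Even k) ∧
      PowerSeries.coeff n (D.logSeries s i) • D.weylGen p =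
        (-((n : ℂ)⁻¹ * (R.map (· ^ k)).sum)) • D.weylGen p := by
  rcases lt_or_gt_of_ne hk with h | h
  · obtain ⟨n, rfl⟩ : ∃ n : ℕ, k = -n := ⟨k.natAbs, by omega⟩
    refine ⟨-1, n, by omega, by ring, by rw [even_neg, Int.even_coe_nat], ?_⟩
    rw [D.coeff_logSeries_smul (T := R.map fun a => a⁻¹)
      fun k => by rw [← minus_revProd hR, ← hp]; exact .pMinus i k, Multiset.map_map]
    simp
  · obtain ⟨n, rfl⟩ : ∃ n : ℕ, k = n := ⟨k.natAbs, by omega⟩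
    refine ⟨1, n, by omega, by ring, by rw [Int.even_coe_nat], ?_⟩
    rw [D.coeff_logSeries_smul (T := R) fun k => by rw [← hp]; exact .pPlus i k]
    simp

open Classical in
-- The degree of `π_i` is the zeroth power sum, so the weight relation extends the formulas for
-- nonzero degrees to degree zero; the doubled weight at a middle node matches the factor `2` in
-- even degrees.
lemma hLoop_zero_smul {i : D.I₀} {R : Multiset ℂ} (hR : ∀ a ∈ R, a ≠ 0) (hp : p i = revProd R) :
    D.toU (D.hLoop i 0) • D.weylGen p =
      ((if D.IsMiddle i then (2 : ℂ) else 1) * (R.map (· ^ (0 : ℤ))).sum) • D.weylGen p := by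
  rw [(WeylRelation.cartan (p := p) i).smul_eq_smul, weight, hp, natDegree_revProd hR]
  simp only [zpow_zero, Multiset.map_const', Multiset.sum_replicate, nsmul_eq_mul, mul_one]
  split_ifs <;> push_cast <;> simp

lemma neg_inv_smul_cancel {V : Type*} [AddCommGroup V] [Module ℂ V] {n : ℕ} (hn : n ≠ 0) {v w : V}
    {c : ℂ} (h : (-(n : ℂ)⁻¹) • v = (-((n : ℂ)⁻¹ * c)) • w) : v = c • w := by
  have hn' : (n : ℂ) ≠ 0 := Nat.cast_ne_zero.mpr hn
  have := congrArg (fun x => (-(n : ℂ)) • x) h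
  simpa only [smul_smul, neg_mul_neg, mul_inv_cancel₀ hn', one_smul, mul_inv_cancel_left₀ hn']
    using this

lemma hLoop_smul_of_isFixed {i : D.I₀} {R : Multiset ℂ} (hR : ∀ a ∈ R, a ≠ 0)
    (hp : p i = revProd R) (hi : D.IsFixed i) (k : ℤ) :
    D.toU (D.hLoop i (D.m * k)) • D.weylGen p = (R.map (· ^ k)).sum • D.weylGen p := by
  rcases eq_or_ne k 0 with rfl | hk
  · rw [mul_zero, D.hLoop_zero_smul hR hp, if_neg hi.not_isMiddle, one_mul]
  obtain ⟨s, n, hn, rfl, -, h⟩ := D.exists_coeff_logSeries_smul hR hp hk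
  rw [logSeries, PowerSeries.coeff_mk, if_neg hn, if_pos hi, smul_assoc] at h
  rw [← neg_inv_smul_cancel hn h, mul_left_comm]

lemma hLoop_smul_of_not {i : D.I₀} {R : Multiset ℂ} (hR : ∀ a ∈ R, a ≠ 0)
    (hp : p i = revProd R) (hi : ¬ D.IsFixed i) (hm : ¬ D.IsMiddle i) (k : ℤ) :
    D.toU (D.hLoop i k) • D.weylGen p = (R.map (· ^ k)).sum • D.weylGen p := by
  rcases eq_or_ne k 0 with rfl | hk
  · rw [D.hLoop_zero_smul hR hp, if_neg hm, one_mul]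
  obtain ⟨s, n, hn, rfl, -, h⟩ := D.exists_coeff_logSeries_smul hR hp hk
  rw [logSeries, PowerSeries.coeff_mk, if_neg hn, if_neg hi, if_neg hm, smul_assoc] at h
  exact neg_inv_smul_cancel hn h

open Classical in
lemma hLoop_smul_of_isMiddle {i : D.I₀} {R : Multiset ℂ} (hR : ∀ a ∈ R, a ≠ 0)
    (hp : p i = revProd R) (hm : D.IsMiddle i) (k : ℤ) :
    D.toU (D.hLoop i k) • D.weylGen p =
      ((if Even k then (2 : ℂ) else -1) * (R.map (· ^ k)).sum) • D.weylGen p := by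
  have hi : ¬ D.IsFixed i := fun h => h.not_isMiddle hm
  rcases eq_or_ne k 0 with rfl | hk
  · rw [D.hLoop_zero_smul hR hp, if_pos hm, if_pos Even.zero]
  obtain ⟨s, n, hn, rfl, he, h⟩ := D.exists_coeff_logSeries_smul hR hp hk
  rw [logSeries, PowerSeries.coeff_mk, if_neg hn, if_neg hi, if_pos hm] at h
  simp only [← he]
  split_ifs at h ⊢
  · rw [smul_assoc, smul_assoc] at h
    rw [mul_smul, ← neg_inv_smul_cancel hn h, smul_smul, mul_inv_cancel₀ two_ne_zero, one_smul]
  · rw [smul_assoc, ← neg_neg ((n : ℂ)⁻¹ • _), ← smul_neg, ← neg_smul] at h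
    rw [mul_smul, ← neg_inv_smul_cancel hn h, neg_smul, one_smul, neg_neg]

lemma exists_loop_h_lie (hp : p ∈ D.polyMonoid) (i : D.I₀) :
    ∃ (R : Multiset ℂ) (θ : ℤ → ℂ), (∀ a ∈ R, a ≠ 0) ∧ (∀ r, θ (r + D.period) = θ r) ∧
      ∀ r, ⁅D.loop r (B.h i), D.weylGen p⁆ =
        θ r • (R.map (· ^ r)).sum • D.weylGen p := by
  classical
  obtain ⟨R, hR, h⟩ := D.exists_eq_revProd hp i
  have hdvd : ∀ r, (D.m : ℤ) ∣ r + D.period ↔ (D.m : ℤ) ∣ r :=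
    fun r => dvd_add_left D.dvd_period
  by_cases hi : D.IsFixed i
  -- At a fixed node degree `m k` carries `a ^ k`; with an `m`-th root of `a` this becomes a power
  -- sum in the true degree, and a periodic factor removes the other degrees.
  · have hroot : ∀ a : ℂ, ∃ z, z ^ D.m = a := fun a => IsAlgClosed.exists_pow_nat_eq a D.m_pos
    choose ρ hρ using hroot
    refine ⟨R.map ρ, fun r => if (D.m : ℤ) ∣ r then (D.m : ℂ) else 0, ?_, ?_, ?_⟩
    · intro b hb
      obtain ⟨a, ha, rfl⟩ := Multiset.mem_map.mp hb
      intro h0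
      have := hρ a
      rw [h0, zero_pow D.m_pos.ne'] at this
      exact hR a ha this.symm
    · intro r
      simp only [hdvd]
    · intro r
      dsimp only
      rw [D.loop_h_of_isFixed hi, smul_lie, weyl_lie]
      split_ifs with hr
      · obtain ⟨k, rfl⟩ := hr
        rw [D.hLoop_smul_of_isFixed hR h hi, Multiset.map_map]
        congr 3
        refine Multiset.map_congr rfl fun a _ => ?_
        rw [Function.comp_apply, zpow_mul, zpow_natCast, hρ]
      · rw [zero_smul, zero_smul]
  · by_cases hm : D.IsMiddle i
    · refine ⟨R, fun r => (if D.IsMiddle i ∧ (D.m : ℤ) ∣ r then (2 : ℂ)⁻¹ else 1) *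
        (if Even r then (2 : ℂ) else -1), hR, fun r => ?_, fun r => ?_⟩
      -- The sign at a middle node depends on the parity of the degree, which the factor `2` in the
      -- period preserves.
      · have : Even (r + D.period) ↔ Even r := by
          rw [Int.even_add, period]
          simp
        simp only [hdvd, this]
      · rw [D.loop_h_of_not_isFixed hi, smul_lie, weyl_lie, D.hLoop_smul_of_isMiddle hR h hm,
          smul_smul, smul_smul, mul_assoc]
    · refine ⟨R, fun _ => 1, hR, fun r => rfl, fun r => ?_⟩
      rw [D.loop_h_of_not_isFixed hi, if_neg fun h => hm h.1, smul_lie, weyl_lie,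
        D.hLoop_smul_of_not hR h hi hm]

lemma isWeylGenerator_weylGen (hp : p ∈ D.polyMonoid) : D.IsWeylGenerator (D.weylGen p) where
  cyclic := D.weyl_cyclic p
  nPlus x hx := (WeylRelation.nPlus (p := p) x hx).smul_eq_zero
  cartan i hi r := by
    obtain ⟨R, θ, -, -, h⟩ := D.exists_loop_h_lie hp ⟨i, hi⟩
    exact ⟨_, by rw [h, smul_smul]⟩
  cartan_recurrent i hi := by
    obtain ⟨R, θ, hR, hθ, h⟩ := D.exists_loop_h_lie hp ⟨i, hi⟩
    simp only [h]
    exact mul_mem_recurrent hθ (powerSum_mem_recurrent D.period hR _)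
  xMinus i hi := by
    obtain ⟨c, hc⟩ := D.exists_loop_f_eq_smul i
    have h : ∀ n : ℕ, ((LieModule.toEnd ℂ D.twistedLoop (D.WeylModule p) (D.xMinusLoop i)) ^ n)
        (D.weylGen p) = D.toU (D.xMinusLoop i) ^ n • D.weylGen p := by
      intro n
      induction n with
      | zero => simp
      | succ n ih =>
        rw [pow_succ', Module.End.mul_apply, ih, pow_succ', mul_smul]
        rfl
    refine ⟨D.weight p ⟨i, hi⟩, ?_⟩
    rw [hc, map_smul, smul_pow, LinearMap.smul_apply, h,
      (WeylRelation.xMinus (p := p) ⟨i, hi⟩).smul_eq_zero, smul_zero]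

end WeylModule

end DiagramAutomorphism
end TwistedLoop
end

theorem mainTheorem5 {ι L : Type*} [Fintype ι] [LieRing L] [LieAlgebra ℂ L]
    [Module.Finite ℂ L] [LieAlgebra.IsSimple ℂ L] {H : LieSubalgebra ℂ L}
    (B : LieAlgebra.Basis ι H) (hB : B.A.IsSimplyLaced)
    (D : TwistedLoop.DiagramAutomorphism B)
    (p : D.I₀ → Polynomial ℂ) (hp : p ∈ D.polyMonoid) :
    Module.Finite ℂ (D.WeylModule p) := by
  exact (D.isWeylGenerator_weylGen hp).finite
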